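/- Let $\mathbb N=\{1,2,3,\dots\}$ and let $c_{00}$ be the space of finitely supported real sequences $(x_j)_{j\in\mathbb N}$; for finite $E\subset\mathbb N$ let $Ex$ be the restriction of $x$ to $E$. For finite sets write $E<F$ if every element of $E$ is smaller than every element of $F$. The Schreier families are $S_0=\{\emptyset\}\cup\{\{n\}:n\in\mathbb N\}$ and, for $n\ge 0$, $S_{n+1}$ is the family of all unions $F_1\cup\dots\cup F_k$ with $k\in\mathbb N$, $F_i\in S_n$ (possibly empty), $F_i<F_j$ for all $i<j$, and every element of every $F_i$ at least $k$. A family $(E_i)$ of finite non-empty subsets of $\mathbb N$ with $\{\min E_i\}_i\in S_n$ is called $S_n$-allowable if the $E_i$ are pairwise disjoint, and $S_n$-admissible if $E_1<E_2<\cdots$. Fix $\theta_n\in(0,1)$ $(n\in\mathbb N)$ with $\lim_n\theta_n=0$, fix $s\in\mathbb N$, and fix $\alpha_n\in(0,1)$ $(n\in\mathbb N)$ with $\sum_n\alpha_n=1$ and, for some $\ell,u\in(0,1)$, $\ell\le\alpha_{n+1}/\alpha_n\le u$ for all $n$. For $x\in c_{00}$ put $\|x\|_{V,0}=\|x\|_{W,0}=\|x\|_\infty$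 and, for $m\ge 0$, $$\|x\|_{V,m+1}=\|x\|_\infty\vee\sup_{n}\sup\Big\{\theta_n\sum_i\|E_ix\|_{V,m}:(E_i)\ S_n\text{-allowable}\Big\},$$ $$\|x\|_{W,m+1}=\|x\|_\infty\vee\sup_{n\le s}\sup\Big\{\theta_n\sum_i\|E_ix\|_{W,m}:(E_i)\ S_n\text{-allowable}\Big\}\vee\sup_{n\ge s+1}\sup\Big\{\theta_n\sum_i\|E_ix\|_{W,m}:(E_i)\ S_n\text{-admissible}\Big\},$$ and let $\|x\|_V=\lim_m\|x\|_{V,m}$, $\|x\|_W=\lim_m\|x\|_{W,m}$. Let $V=T_M(\theta_n,S_n)_n$ and $W=T_{M(s)}(\theta_n,S_n)_n$ be the completions of $c_{00}$ under $\|\cdot\|_V$ and $\|\cdot\|_W$, and let $V'=\Sigma(\alpha_n\|\cdot\|_{V,n})$ and $W'=\Sigma(\alpha_n\|\cdot\|_{W,n})$ be the completions of $c_{00}$ under $\sum_{n=1}^\infty\alpha_n\|x\|_{V,n}$ and $\sum_{n=1}^\infty\alpha_n\|x\|_{W,n}$. Then neither $V$ nor $W$ has a subspace isomorphic (linearly homeomorphic)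 to $\ell_1$. The spaces $V'$ and $W'$ are $\ell_1$-saturated, that is, each of their closed infinite-dimensional subspaces has a subspace isomorphic to $\ell_1$; but neither $V'$ nor $W'$ is isomorphic to $\ell_1$. -/

import Mathlib

noncomputable section

open Set Filter Topology
open scoped Pointwise

namespace MixedTsirelson

/-- The space `c₀₀` of finitely supported real sequences indexed by `1, 2, 3, …`. -/
abbrev C00 : Type := ℕ+ →₀ ℝ

/-- `E < F` for finite sets: every element of `E` is smaller than every element of `F`
(vacuous if one of them is empty). -/
def Before (E F : Finset ℕ+) : Prop := ∀ a ∈ E, ∀ b ∈ F, a < b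

/-- The Schreier families `S₀, S₁, S₂, …`.  A member of `S_{n+1}` is a union of `k` members
`G₁ < ⋯ < G_k` of `S_n` (possibly empty ones, the order being required of every pair) whose
elements are all at least `k`. -/
def schreier : ℕ → Set (Finset ℕ+)
  | 0 => {F | F = ∅ ∨ ∃ j : ℕ+, F = {j}}
  | n + 1 => {F | ∃ (k : ℕ+) (G : Fin (k : ℕ) → Finset ℕ+),
      (∀ i, G i ∈ schreier n) ∧ (∀ i, ∀ a ∈ G i, k ≤ a) ∧
      (∀ i j, i < j → Before (G i) (G j)) ∧ F = Finset.univ.biUnion G}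

/-- The set of minima of the members of `𝓔` belongs to `S_n`. -/
def MinsInSchreier (n : ℕ) (𝓔 : Finset (Finset ℕ+)) : Prop :=
  ∃ F ∈ schreier n, (F : Set ℕ+) = {j | ∃ E ∈ 𝓔, IsLeast (E : Set ℕ+) j}

/-- `S_n`-allowable families of finite nonempty sets.  As the sets are nonempty and pairwise
disjoint, the family is determined by the set `𝓔` of its members. -/
structure IsAllowable (n : ℕ) (𝓔 : Finset (Finset ℕ+)) : Prop where
  nonempty : ∀ E ∈ 𝓔, E.Nonempty
  disjoint : ∀ E ∈ 𝓔, ∀ F ∈ 𝓔, E ≠ F → Disjoint E F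
  mins : MinsInSchreier n 𝓔

/-- `S_n`-admissible families of finite nonempty sets: the members can be enumerated as
`E₁ < E₂ < ⋯`, and their minima form a set in `S_n`. -/
structure IsAdmissible (n : ℕ) (𝓔 : Finset (Finset ℕ+)) : Prop where
  nonempty : ∀ E ∈ 𝓔, E.Nonempty
  successive : ∀ E ∈ 𝓔, ∀ F ∈ 𝓔, E ≠ F → Before E F ∨ Before F E
  mins : MinsInSchreier n 𝓔

/-- The restriction `E x` of a vector `x` to a finite set `E`. -/
def restrict (E : Finset ℕ+) (x : C00) : C00 := x.filter (· ∈ E)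

/-- The norm `‖x‖_∞`. -/
def supNorm (x : C00) : ℝ := ⨆ j : ℕ+, |x j|

/-- The values `θ_n ∑_i N (E_i x)`, where `n ≥ 1` and `(E_i)` is one of the families in `A n`. -/
def values (θ : ℕ+ → ℝ) (A : ℕ+ → Set (Finset (Finset ℕ+))) (N : C00 → ℝ) (x : C00) : Set ℝ :=
  {r | ∃ n : ℕ+, ∃ 𝓔 ∈ A n, r = θ n * ∑ E ∈ 𝓔, N (restrict E x)}

/-- `‖x‖_∞ ∨ sup_n sup {θ_n ∑_i N (E_i x) : (E_i) ∈ A n}`. -/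
def step (θ : ℕ+ → ℝ) (A : ℕ+ → Set (Finset (Finset ℕ+))) (N : C00 → ℝ) (x : C00) : ℝ :=
  max (supNorm x) (sSup (values θ A N x))

/-- The sequence of norms which starts with `‖·‖_∞` and is produced by iterating `step`. -/
def iterNorm (θ : ℕ+ → ℝ) (A : ℕ+ → Set (Finset (Finset ℕ+))) : ℕ → C00 → ℝ
  | 0 => supNorm
  | m + 1 => step θ A (iterNorm θ A m)

/-- The limit of the (nondecreasing) sequence of iterated norms; see `tendsto_iterNorm` and
`limNorm_eq_step`. -/
def limNorm (θ : ℕ+ → ℝ) (A : ℕ+ → Set (Finset (Finset ℕ+))) (x : C00) : ℝ :=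
  ⨆ m : ℕ, iterNorm θ A m x

/-- The families used for `V`: all `S_n`-allowable ones. -/
def famV (n : ℕ+) : Set (Finset (Finset ℕ+)) := {𝓔 | IsAllowable n 𝓔}

/-- The families used for `W`: the `S_n`-allowable ones if `n ≤ s`, and the `S_n`-admissible
ones if `n ≥ s + 1`. -/
def famW (s : ℕ+) (n : ℕ+) : Set (Finset (Finset ℕ+)) :=
  {𝓔 | (n ≤ s ∧ IsAllowable n 𝓔) ∨ (s + 1 ≤ n ∧ IsAdmissible n 𝓔)}

/-! ### The functions above are norms -/

/-- The families in every `A n` consist of pairwise disjoint sets. -/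
def DisjointFams (A : ℕ+ → Set (Finset (Finset ℕ+))) : Prop :=
  ∀ n, ∀ 𝓔 ∈ A n, ∀ E ∈ 𝓔, ∀ F ∈ 𝓔, E ≠ F → Disjoint E F

theorem disjointFams_famV : DisjointFams famV := fun _ _ h => h.disjoint

theorem disjointFams_famW (s : ℕ+) : DisjointFams (famW s) := by
  rintro n 𝓔 (⟨-, h⟩ | ⟨-, h⟩) E hE F hF hne
  · exact h.disjoint E hE F hF hne
  · rw [Finset.disjoint_left]
    intro a haE haF
    rcases h.successive E hE F hF hne with h' | h'
    · exact lt_irrefl _ (h' a haE a haF)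
    · exact lt_irrefl _ (h' a haF a haE)

/-- The norm of `ℓ₁` on `c₀₀`, an upper bound for all norms considered here. -/
def l1Norm (x : C00) : ℝ := ∑ j ∈ x.support, |x j|

theorem l1Norm_nonneg (x : C00) : 0 ≤ l1Norm x := Finset.sum_nonneg fun _ _ => abs_nonneg _

theorem abs_le_l1Norm (x : C00) (j : ℕ+) : |x j| ≤ l1Norm x := by
  by_cases h : j ∈ x.support
  · exact Finset.single_le_sum (f := fun j => |x j|) (fun _ _ => abs_nonneg _) h
  · rw [Finsupp.notMem_support_iff.1 h, abs_zero]
    exact l1Norm_nonneg x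

theorem bddAbove_abs (x : C00) : BddAbove (range fun j : ℕ+ => |x j|) :=
  ⟨l1Norm x, by rintro _ ⟨j, rfl⟩; exact abs_le_l1Norm x j⟩

theorem abs_le_supNorm (x : C00) (j : ℕ+) : |x j| ≤ supNorm x := le_ciSup (bddAbove_abs x) j

theorem supNorm_le_l1Norm (x : C00) : supNorm x ≤ l1Norm x := ciSup_le (abs_le_l1Norm x)

theorem sum_l1Norm_restrict_le (𝓔 : Finset (Finset ℕ+))
    (h : ∀ E ∈ 𝓔, ∀ F ∈ 𝓔, E ≠ F → Disjoint E F) (x : C00) :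
    ∑ E ∈ 𝓔, l1Norm (restrict E x) ≤ l1Norm x := by
  have h1 : ∀ E : Finset ℕ+, l1Norm (restrict E x) = ∑ j ∈ x.support.filter (· ∈ E), |x j| := by
    intro E
    unfold l1Norm restrict
    rw [Finsupp.support_filter]
    refine Finset.sum_congr rfl fun j hj => ?_
    rw [Finsupp.filter_apply_pos _ _ (Finset.mem_filter.1 hj).2]
  simp_rw [h1]
  rw [← Finset.sum_biUnion]
  · refine Finset.sum_le_sum_of_subset_of_nonneg ?_ fun _ _ _ => abs_nonneg _
    intro j hj
    obtain ⟨E, -, hE⟩ := Finset.mem_biUnion.1 hj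
    exact (Finset.mem_filter.1 hE).1
  · intro E hE F hF hne
    refine Finset.disjoint_left.2 fun j hj hj' => ?_
    exact Finset.disjoint_left.1 (h E hE F hF hne) (Finset.mem_filter.1 hj).2
      (Finset.mem_filter.1 hj').2

/-- A seminorm on `c₀₀` which lies between `0` and the norm of `ℓ₁`. -/
structure Tame (N : C00 → ℝ) : Prop where
  add : ∀ x y, N (x + y) ≤ N x + N y
  smul : ∀ (c : ℝ) x, N (c • x) = |c| * N x
  nonneg : ∀ x, 0 ≤ N x
  le_l1 : ∀ x, N x ≤ l1Norm x

theorem tame_supNorm : Tame supNorm where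
  add x y := ciSup_le fun j => by
    rw [Finsupp.add_apply]
    exact (abs_add_le _ _).trans (add_le_add (abs_le_supNorm x j) (abs_le_supNorm y j))
  smul c x := by
    unfold supNorm
    rw [Real.mul_iSup_of_nonneg (abs_nonneg c)]
    simp [abs_mul]
  nonneg x := Real.iSup_nonneg fun _ => abs_nonneg _
  le_l1 := supNorm_le_l1Norm

section

variable {θ : ℕ+ → ℝ} {A : ℕ+ → Set (Finset (Finset ℕ+))} {N : C00 → ℝ}

theorem le_of_mem_values (hθ : ∀ n, θ n ∈ Ioo (0 : ℝ) 1) (hA : DisjointFams A)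
    (hN : ∀ x, N x ≤ l1Norm x) (x : C00) : ∀ r ∈ values θ A N x, r ≤ l1Norm x := by
  rintro _ ⟨n, 𝓔, h𝓔, rfl⟩
  calc θ n * ∑ E ∈ 𝓔, N (restrict E x)
      ≤ θ n * l1Norm x := mul_le_mul_of_nonneg_left
        ((Finset.sum_le_sum fun E _ => hN _).trans (sum_l1Norm_restrict_le 𝓔 (hA n 𝓔 h𝓔) x))
        (hθ n).1.le
    _ ≤ 1 * l1Norm x := mul_le_mul_of_nonneg_right (hθ n).2.le (l1Norm_nonneg x)
    _ = l1Norm x := one_mul _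

theorem le_step (hθ : ∀ n, θ n ∈ Ioo (0 : ℝ) 1) (hA : DisjointFams A)
    (hN : ∀ x, N x ≤ l1Norm x) (x : C00) {n : ℕ+} {𝓔 : Finset (Finset ℕ+)} (h𝓔 : 𝓔 ∈ A n) :
    θ n * ∑ E ∈ 𝓔, N (restrict E x) ≤ step θ A N x :=
  (le_csSup ⟨_, le_of_mem_values hθ hA hN x⟩ ⟨n, 𝓔, h𝓔, rfl⟩).trans (le_max_right _ _)

theorem step_le {x : C00} {b : ℝ} (hb : 0 ≤ b) (h0 : supNorm x ≤ b)
    (h : ∀ n, ∀ 𝓔 ∈ A n, θ n * ∑ E ∈ 𝓔, N (restrict E x) ≤ b) : step θ A N x ≤ b := by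
  refine max_le h0 (Real.sSup_le ?_ hb)
  rintro _ ⟨n, 𝓔, h𝓔, rfl⟩
  exact h n 𝓔 h𝓔

theorem Tame.step (hθ : ∀ n, θ n ∈ Ioo (0 : ℝ) 1) (hA : DisjointFams A) (hN : Tame N) :
    Tame (step θ A N) := by
  have hnn : ∀ x, 0 ≤ MixedTsirelson.step θ A N x := fun x =>
    (tame_supNorm.nonneg x).trans (le_max_left _ _)
  refine ⟨fun x y => ?_, fun c x => ?_, hnn, fun x => ?_⟩
  · refine step_le (add_nonneg (hnn x) (hnn y)) ?_ fun n 𝓔 h𝓔 => ?_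
    · exact (tame_supNorm.add x y).trans (add_le_add (le_max_left _ _) (le_max_left _ _))
    · refine le_trans ?_ (add_le_add (le_step hθ hA hN.le_l1 x h𝓔) (le_step hθ hA hN.le_l1 y h𝓔))
      rw [← mul_add, ← Finset.sum_add_distrib]
      refine mul_le_mul_of_nonneg_left (Finset.sum_le_sum fun E _ => ?_) (hθ n).1.le
      rw [restrict, Finsupp.filter_add]
      exact hN.add _ _
  · have hv : values θ A N (c • x) = |c| • values θ A N x := by
      ext r
      constructor
      · rintro ⟨n, 𝓔, h𝓔, rfl⟩
        refine ⟨_, ⟨n, 𝓔, h𝓔, rfl⟩, ?_⟩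
        simp only [restrict, Finsupp.filter_smul, hN.smul, ← Finset.mul_sum, smul_eq_mul]
        ring
      · rintro ⟨_, ⟨n, 𝓔, h𝓔, rfl⟩, rfl⟩
        refine ⟨n, 𝓔, h𝓔, ?_⟩
        simp only [restrict, Finsupp.filter_smul, hN.smul, ← Finset.mul_sum, smul_eq_mul]
        ring
    rw [MixedTsirelson.step, hv, Real.sSup_smul_of_nonneg (abs_nonneg c), tame_supNorm.smul,
      smul_eq_mul, ← mul_max_of_nonneg _ _ (abs_nonneg c)]
    rfl
  · refine step_le (l1Norm_nonneg x) (supNorm_le_l1Norm x) fun n 𝓔 h𝓔 => ?_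
    exact le_of_mem_values hθ hA hN.le_l1 x _ ⟨n, 𝓔, h𝓔, rfl⟩

theorem tame_iterNorm (hθ : ∀ n, θ n ∈ Ioo (0 : ℝ) 1) (hA : DisjointFams A) (m : ℕ) :
    Tame (iterNorm θ A m) := by
  induction m with
  | zero => exact tame_supNorm
  | succ m ih => exact ih.step hθ hA

theorem bddAbove_iterNorm (hθ : ∀ n, θ n ∈ Ioo (0 : ℝ) 1) (hA : DisjointFams A) (x : C00) :
    BddAbove (range fun m => iterNorm θ A m x) :=
  ⟨l1Norm x, by rintro _ ⟨m, rfl⟩; exact (tame_iterNorm hθ hA m).le_l1 x⟩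

theorem iterNorm_le_succ (hθ : ∀ n, θ n ∈ Ioo (0 : ℝ) 1) (hA : DisjointFams A) (m : ℕ) :
    ∀ x, iterNorm θ A m x ≤ iterNorm θ A (m + 1) x := by
  induction m with
  | zero => exact fun x => le_max_left _ _
  | succ m ih =>
    intro x
    refine step_le ((tame_iterNorm hθ hA (m + 2)).nonneg x) (le_max_left _ _) fun n 𝓔 h𝓔 => ?_
    exact (mul_le_mul_of_nonneg_left (Finset.sum_le_sum fun E _ => ih _) (hθ n).1.le).trans
      (le_step hθ hA (tame_iterNorm hθ hA (m + 1)).le_l1 x h𝓔)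

theorem tendsto_iterNorm (hθ : ∀ n, θ n ∈ Ioo (0 : ℝ) 1) (hA : DisjointFams A) (x : C00) :
    Tendsto (fun m => iterNorm θ A m x) atTop (𝓝 (limNorm θ A x)) :=
  tendsto_atTop_ciSup (monotone_nat_of_le_succ fun m => iterNorm_le_succ hθ hA m x)
    (bddAbove_iterNorm hθ hA x)

theorem iterNorm_le_limNorm (hθ : ∀ n, θ n ∈ Ioo (0 : ℝ) 1) (hA : DisjointFams A) (m : ℕ)
    (x : C00) : iterNorm θ A m x ≤ limNorm θ A x := le_ciSup (bddAbove_iterNorm hθ hA x) m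

theorem tame_limNorm (hθ : ∀ n, θ n ∈ Ioo (0 : ℝ) 1) (hA : DisjointFams A) :
    Tame (limNorm θ A) where
  add x y := ciSup_le fun m => ((tame_iterNorm hθ hA m).add x y).trans
    (add_le_add (iterNorm_le_limNorm hθ hA m x) (iterNorm_le_limNorm hθ hA m y))
  smul c x := by
    unfold limNorm
    rw [Real.mul_iSup_of_nonneg (abs_nonneg c)]
    simp_rw [(tame_iterNorm hθ hA _).smul]
  nonneg x := Real.iSup_nonneg fun m => (tame_iterNorm hθ hA m).nonneg x
  le_l1 x := ciSup_le fun m => (tame_iterNorm hθ hA m).le_l1 x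

/-- The limit norm satisfies the implicit equation of the mixed Tsirelson norms. -/
theorem limNorm_eq_step (hθ : ∀ n, θ n ∈ Ioo (0 : ℝ) 1) (hA : DisjointFams A) (x : C00) :
    limNorm θ A x = step θ A (limNorm θ A) x := by
  have hl := tame_limNorm hθ hA
  apply le_antisymm
  · refine ciSup_le fun m => (iterNorm_le_succ hθ hA m x).trans ?_
    refine step_le ((hl.step hθ hA).nonneg x) (le_max_left _ _) fun n 𝓔 h𝓔 => ?_
    exact (mul_le_mul_of_nonneg_left
      (Finset.sum_le_sum fun E _ => iterNorm_le_limNorm hθ hA m _) (hθ n).1.le).trans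
      (le_step hθ hA hl.le_l1 x h𝓔)
  · refine step_le (hl.nonneg x) (iterNorm_le_limNorm hθ hA 0 x) fun n 𝓔 h𝓔 => ?_
    refine le_of_tendsto' ((tendsto_finsetSum 𝓔 fun E _ =>
      tendsto_iterNorm hθ hA (restrict E x)).const_mul (θ n)) fun m => ?_
    exact (le_step hθ hA (tame_iterNorm hθ hA m).le_l1 x h𝓔).trans
      (iterNorm_le_limNorm hθ hA (m + 1) x)

end

/-- The bundled seminorm given by a tame function. -/
def Tame.toSeminorm {N : C00 → ℝ} (hN : Tame N) : Seminorm ℝ C00 :=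
  Seminorm.of N hN.add fun c x => by rw [hN.smul, Real.norm_eq_abs]

/-- `∑_{n ≥ 1} α_n N_n(x)`. -/
def weightedSum (α : ℕ+ → ℝ) (N : ℕ+ → C00 → ℝ) (x : C00) : ℝ := ∑' n, α n * N n x

theorem summable_weighted {α : ℕ+ → ℝ} {N : ℕ+ → C00 → ℝ} (hα : ∀ n, α n ∈ Ioo (0 : ℝ) 1)
    (hsum : HasSum α 1) (hN : ∀ n, Tame (N n)) (x : C00) : Summable fun n => α n * N n x :=
  Summable.of_nonneg_of_le (fun n => mul_nonneg (hα n).1.le ((hN n).nonneg x))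
    (fun n => mul_le_mul_of_nonneg_left ((hN n).le_l1 x) (hα n).1.le)
    (hsum.summable.mul_right (l1Norm x))

theorem tame_weightedSum {α : ℕ+ → ℝ} {N : ℕ+ → C00 → ℝ} (hα : ∀ n, α n ∈ Ioo (0 : ℝ) 1)
    (hsum : HasSum α 1) (hN : ∀ n, Tame (N n)) : Tame (weightedSum α N) where
  add x y := by
    have hx := summable_weighted hα hsum hN x
    have hy := summable_weighted hα hsum hN y
    unfold weightedSum
    rw [← hx.tsum_add hy]
    refine (summable_weighted hα hsum hN (x + y)).tsum_le_tsum (fun n => ?_) (hx.add hy)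
    rw [← mul_add]
    exact mul_le_mul_of_nonneg_left ((hN n).add x y) (hα n).1.le
  smul c x := by
    unfold weightedSum
    rw [← tsum_mul_left]
    refine tsum_congr fun n => ?_
    rw [(hN n).smul]
    ring
  nonneg x := tsum_nonneg fun n => mul_nonneg (hα n).1.le ((hN n).nonneg x)
  le_l1 x := by
    have h : weightedSum α N x ≤ ∑' n, α n * l1Norm x :=
      (summable_weighted hα hsum hN x).tsum_le_tsum
        (fun n => mul_le_mul_of_nonneg_left ((hN n).le_l1 x) (hα n).1.le)
        (hsum.summable.mul_right _)
    rwa [tsum_mul_right, hsum.tsum_eq, one_mul] at h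

/-! ### The four Banach spaces -/

/-- The vector space `c₀₀` equipped with `p` as its norm. -/
def Normed (_p : Seminorm ℝ C00) : Type := C00

instance (p : Seminorm ℝ C00) : SeminormedAddCommGroup (Normed p) :=
  AddGroupSeminorm.toSeminormedAddCommGroup (E := C00) p.toAddGroupSeminorm

instance (p : Seminorm ℝ C00) : NormedSpace ℝ (Normed p) where
  toModule := inferInstanceAs (Module ℝ C00)
  norm_smul_le c x := le_of_eq (p.smul' c x)

/-- The Banach space obtained by completing `(c₀₀, p)`. -/
abbrev Compl (p : Seminorm ℝ C00) : Type := UniformSpace.Completion (Normed p)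

/-- The space `V = T_M(θ_n, S_n)_n`. -/
abbrev V (θ : ℕ+ → ℝ) (hθ : ∀ n, θ n ∈ Ioo (0 : ℝ) 1) : Type :=
  Compl (tame_limNorm hθ disjointFams_famV).toSeminorm

/-- The space `W = T_{M(s)}(θ_n, S_n)_n`. -/
abbrev W (s : ℕ+) (θ : ℕ+ → ℝ) (hθ : ∀ n, θ n ∈ Ioo (0 : ℝ) 1) : Type :=
  Compl (tame_limNorm hθ (disjointFams_famW s)).toSeminorm

/-- The space `V' = Σ(α_n ‖·‖_{V,n})`. -/
abbrev V' (θ : ℕ+ → ℝ) (hθ : ∀ n, θ n ∈ Ioo (0 : ℝ) 1)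
    (α : ℕ+ → ℝ) (hα : ∀ n, α n ∈ Ioo (0 : ℝ) 1) (hsum : HasSum α 1) : Type :=
  Compl (tame_weightedSum (N := fun n : ℕ+ => iterNorm θ famV n) hα hsum
    fun n => tame_iterNorm hθ disjointFams_famV n).toSeminorm

/-- The space `W' = Σ(α_n ‖·‖_{W,n})`. -/
abbrev W' (s : ℕ+) (θ : ℕ+ → ℝ) (hθ : ∀ n, θ n ∈ Ioo (0 : ℝ) 1)
    (α : ℕ+ → ℝ) (hα : ∀ n, α n ∈ Ioo (0 : ℝ) 1) (hsum : HasSum α 1) : Type :=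
  Compl (tame_weightedSum (N := fun n : ℕ+ => iterNorm θ (famW s) n) hα hsum
    fun n => tame_iterNorm hθ (disjointFams_famW s) n).toSeminorm

/-! ### Isomorphs of `ℓ₁` -/

/-- The real Banach space `ℓ₁`. -/
abbrev Ell1 : Type := lp (fun _ : ℕ => ℝ) 1

section

variable (X : Type*) [NormedAddCommGroup X] [NormedSpace ℝ X]

/-- `X` is isomorphic (linearly homeomorphic) to `ℓ₁`. -/
def IsomorphicToEll1 : Prop := Nonempty (X ≃L[ℝ] Ell1)

/-- Some subspace of `X` is isomorphic to `ℓ₁`. -/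
def ContainsEll1 : Prop := ∃ Y : Submodule ℝ X, IsomorphicToEll1 Y

/-- Every closed infinite-dimensional subspace of `X` has a subspace isomorphic to `ℓ₁`. -/
def IsEll1Saturated : Prop :=
  ∀ Y : Submodule ℝ X, IsClosed (Y : Set X) → ¬ FiniteDimensional ℝ Y →
    ∃ Z : Submodule ℝ X, Z ≤ Y ∧ IsomorphicToEll1 Z

end

end MixedTsirelson

end

/-! The limit norm is the supremum over a set of nonnegative functionals (`Norming`) paired with
|x|; its pointwise closure K is compact in [0,1]^ℕ. Schreier families being compact and θ_n tending
to 0, a nonzero f in K either has finite support or is θ_n times a finite sum of disjointly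
supported members of K (`exists_decomposition`). Unfolding m times turns f, far out, into finitely
many disjoint members of K with weights at most Θ^m, where Θ < 1 bounds all θ_n; finitely many sets
far out form an S_1-allowable family, so on tails f is at most Θ^m/θ_1 times the norm
(`exists_tail_estimate`). Hence bounded coordinatewise null sequences are pointwise null on K
(`tendsto_pairing`), and by Hahn–Banach, Riesz and dominated convergence they have convex
combinations of small norm. Differences along a coordinatewise convergent subsequence of an
ℓ₁-sequence would be a counterexample, so V and W do not contain ℓ₁.

For the sum norms, the point is that no iterated norm dominates the next one on a subspace: by
induction on m, every subspace of c₀₀ with vectors arbitrarily far out has a block sequence bounded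
below in the m-th norm with bounded partial sums (`hasC0Sequences_iterNorm`). Sums of n such vectors
stay bounded in the m-th norm but have size at least θ_1 n in the next. This yields vectors of sum
norm 1 on which any prescribed iterated norm is small, and a gliding hump through the summands
α_n‖·‖_n extracts an ℓ₁-sequence (`exists_subseq_lower_l1`). A perturbation carries this to closed
subspaces of V' and W'.

V' and W' are not ℓ₁ itself: in ℓ₁ a coordinatewise null sequence bounded below has a subsequence
with a lower ℓ₁ estimate, whereas differences of unit vectors have convex combinations that are
small in the limit norm, hence in the smaller sum norm. -/

noncomputable section

open Set Filter Topology
open scoped Pointwise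

namespace MixedTsirelson

/-! ### Convex combinations of pointwise null sequences on a compact space -/

/-- Otherwise Hahn–Banach separates the functions below ε from the convex hull of the g k. The
separating functional is positive, hence integration against a finite measure, and dominated
convergence contradicts its lower bound on the g k. -/
theorem exists_convexCombination_le {X : Type*} [TopologicalSpace X] [CompactSpace X] [T2Space X]
    (g : ℕ → C(X, ℝ)) {C : ℝ} (h0 : ∀ k x, 0 ≤ g k x) (hC : ∀ k x, g k x ≤ C)
    (hlim : ∀ x, Tendsto (fun k => g k x) atTop (𝓝 0)) {ε : ℝ} (hε : 0 < ε) :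
    ∃ (n : ℕ) (a : ℕ → ℝ), (∀ k, 0 ≤ a k) ∧ ∑ k ∈ Finset.range n, a k = 1 ∧
      ∀ x, ∑ k ∈ Finset.range n, a k * g k x ≤ ε := by
  let D : Set (ℕ →₀ ℝ) := {a | (∀ k, 0 ≤ a k) ∧ Finsupp.linearCombination ℝ (fun _ => (1 : ℝ)) a = 1}
  let T := Finsupp.linearCombination ℝ g
  have hrange : ∀ a : ℕ →₀ ℝ, ∃ n, a.support ⊆ Finset.range n := fun a =>
    a.support.exists_nat_subset_range
  have hsum : ∀ (a : ℕ →₀ ℝ) (n : ℕ), a.support ⊆ Finset.range n → ∀ x,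
      T a x = ∑ k ∈ Finset.range n, a k * g k x := by
    intro a n hn x
    simp only [T]
    rw [Finsupp.linearCombination_apply, Finsupp.sum_of_support_subset a hn _ (by simp),
      ContinuousMap.sum_apply]
    simp
  by_contra hcon
  have hDconv : Convex ℝ D := by
    rintro a ⟨ha, ha1⟩ b ⟨hb, hb1⟩ s t hs ht hst
    refine ⟨fun k => ?_, ?_⟩
    · have := mul_nonneg hs (ha k)
      have := mul_nonneg ht (hb k)
      simp only [Finsupp.add_apply, Finsupp.smul_apply, smul_eq_mul]
      linarith
    · rw [map_add, map_smul, map_smul, ha1, hb1]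
      simpa using hst
  let U : Set C(X, ℝ) := {h | ∀ x, h x < ε}
  have hUopen : IsOpen U := by
    have := ContinuousMap.isOpen_setOfPred_mapsTo (X := X) (Y := ℝ) isCompact_univ
      (isOpen_Iio (a := ε))
    convert this using 1
    ext h
    simp [U, MapsTo]
  have hUconv : Convex ℝ U := by
    intro a ha b hb s t hs ht hst x
    have h1 : s • a x + t • b x < ε := (convex_Iio ε) (ha x) (hb x) hs ht hst
    simpa using h1
  have hdisj : Disjoint U (T '' D) := by
    rw [Set.disjoint_left]
    rintro h hU ⟨a, ⟨ha, ha1⟩, rfl⟩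
    obtain ⟨n, hn⟩ := hrange a
    refine hcon ⟨n, a, ha, ?_, fun x => ?_⟩
    · rw [← ha1, Finsupp.linearCombination_apply, Finsupp.sum_of_support_subset a hn _ (by simp)]
      simp
    · rw [← hsum a n hn x]
      exact (hU x).le
  obtain ⟨Λ, u, hΛU, hΛT⟩ := geometric_hahn_banach_open hUconv hUopen
    (hDconv.linear_image T) hdisj
  have hu : 0 < u := by simpa using hΛU 0 (fun x => by simpa using hε)
  -- `U` contains every nonpositive function, so `Λ` is bounded above by `u` on all multiples -n f.
  have hΛpos : ∀ f : C(X, ℝ), (∀ x, 0 ≤ f x) → 0 ≤ Λ f := by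
    intro f hf
    by_contra! hneg
    obtain ⟨n, hn⟩ := exists_nat_gt (u / (-Λ f))
    have h1 : Λ (-(n : ℝ) • f) < u := hΛU _ fun x => by
      have := mul_nonneg n.cast_nonneg (hf x) (α := ℝ)
      simp only [ContinuousMap.smul_apply, smul_eq_mul, neg_mul]
      linarith
    rw [map_smul, smul_eq_mul] at h1
    rw [div_lt_iff₀ (by linarith)] at hn
    linarith
  let _ : MeasurableSpace X := borel X
  have : BorelSpace X := ⟨rfl⟩
  let e : C(X, ℝ) → CompactlySupportedContinuousMap X ℝ :=
    CompactlySupportedContinuousMap.continuousMapEquiv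
  let Λ' : CompactlySupportedContinuousMap X ℝ →ₚ[ℝ] ℝ := PositiveLinearMap.mk₀
    { toFun := fun f => Λ f.toContinuousMap
      map_add' := fun f g => Λ.map_add f.toContinuousMap g.toContinuousMap
      map_smul' := fun c f => Λ.map_smul c f.toContinuousMap }
    (fun f hf => hΛpos _ hf)
  have hint : ∀ f : C(X, ℝ), ∫ x, f x ∂(RealRMK.rieszMeasure Λ') = Λ f := fun f =>
    RealRMK.integral_rieszMeasure Λ' (e f)
  have : MeasureTheory.IsFiniteMeasureOnCompacts (RealRMK.rieszMeasure Λ') := by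
    infer_instance
  have : MeasureTheory.IsFiniteMeasure (RealRMK.rieszMeasure Λ') := by infer_instance
  have htend : Tendsto (fun k => ∫ x, g k x ∂(RealRMK.rieszMeasure Λ')) atTop
      (𝓝 (∫ _, (0 : ℝ) ∂(RealRMK.rieszMeasure Λ'))) := by
    refine MeasureTheory.tendsto_integral_of_dominated_convergence (fun _ => C)
      (fun k => (g k).continuous.aestronglyMeasurable) (MeasureTheory.integrable_const C)
      (fun k => Eventually.of_forall fun x => ?_) (Eventually.of_forall hlim)
    rw [Real.norm_eq_abs, abs_of_nonneg (h0 k x)]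
    exact hC k x
  simp only [hint, MeasureTheory.integral_zero] at htend
  refine absurd (ge_of_tendsto' htend fun k => ?_) (not_le.2 hu)
  refine hΛT _ ⟨Finsupp.single k 1, ⟨fun j => ?_, by simp⟩, by simp [T]⟩
  by_cases hj : j = k <;> simp [hj]

/-! ### Lower `ℓ₁` estimates -/

/-- A sequence along which countably many seminorms tend to `0`, while their sum does not, has a
subsequence with a lower `ℓ₁` estimate. -/
theorem exists_subseq_lower_l1 {E : Type*} [AddCommGroup E] [Module ℝ E] (ν : ℕ → Seminorm ℝ E)
    (w : ℕ → E) (hs : ∀ x, Summable fun n => ν n x) {c : ℝ} (hc : 0 < c)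
    (hw : ∀ k, c ≤ ∑' n, ν n (w k)) (h0 : ∀ n, Tendsto (fun k => ν n (w k)) atTop (𝓝 0)) :
    ∃ φ : ℕ → ℕ, StrictMono φ ∧ ∀ (m : ℕ) (a : ℕ → ℝ),
      c / 2 * ∑ k ∈ Finset.range m, |a k| ≤
        ∑' n, ν n (∑ k ∈ Finset.range m, a k • w (φ k)) := by
  -- Gliding hump: the next vector loses at most c/8 on the seminorms before the window and at most
  -- c/8 on those after it.
  have hstep : ∀ p : ℕ × ℕ, ∃ q : ℕ × ℕ, p.1 < q.1 ∧ p.2 ≤ q.2 ∧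
      ∑' n, ν n (w q.1) ≤ ∑ n ∈ Finset.Ico p.2 q.2, ν n (w q.1) + c / 4 := by
    rintro ⟨k, N⟩
    have h1 : Tendsto (fun j => ∑ n ∈ Finset.range N, ν n (w j)) atTop (𝓝 0) := by
      simpa using tendsto_finsetSum (Finset.range N) fun n _ => h0 n
    obtain ⟨j, hj, hkj⟩ := ((h1.eventually (gt_mem_nhds (show (0 : ℝ) < c / 8 by positivity))).and
      (eventually_gt_atTop k)).exists
    have h2 := (hs (w j)).hasSum.tendsto_sum_nat
    obtain ⟨N', hN', hNN'⟩ := ((h2.eventually (lt_mem_nhds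
      (show ∑' n, ν n (w j) - c / 8 < ∑' n, ν n (w j) by linarith))).and
      (eventually_ge_atTop N)).exists
    refine ⟨(j, N'), hkj, hNN', ?_⟩
    rw [← Finset.sum_range_add_sum_Ico _ hNN'] at hN'
    simp only
    linarith
  choose f hf1 hf2 hf3 using hstep
  let S : ℕ → ℕ × ℕ := fun k => Nat.rec (0, 0) (fun _ p => f p) k
  have hS : ∀ k, S (k + 1) = f (S k) := fun k => rfl
  refine ⟨fun k => (S (k + 1)).1, strictMono_nat_of_lt_succ fun k => hf1 (S (k + 1)), ?_⟩
  intro m a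
  set v : ℕ → E := fun k => w (S (k + 1)).1 with hv
  set N : ℕ → ℕ := fun k => (S k).2 with hN
  have hmono : ∀ k, N k ≤ N (k + 1) := fun k => hf2 (S k)
  have hconc : ∀ (F : ℕ → ℝ) (m : ℕ), ∑ k ∈ Finset.range m, ∑ n ∈ Finset.Ico (N k) (N (k + 1)), F n
      = ∑ n ∈ Finset.range (N m), F n := by
    intro F m
    induction m with
    | zero => simp [hN, S]
    | succ m ih => rw [Finset.sum_range_succ, ih, Finset.sum_range_add_sum_Ico _ (hmono m)]
  set x : E := ∑ k ∈ Finset.range m, a k • v k with hx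
  -- The triangle inequality, with the k-th term added and subtracted so that the negative sum runs
  -- over all j. The windows then add up to one range, and each k contributes at least |a k| (2(s -
  -- c/4) - s) ≥ |a k| c/2, where s ≥ c is the total mass of v k.
  have hpoint : ∀ k ∈ Finset.range m, ∀ n,
      2 * (|a k| * ν n (v k)) - ∑ j ∈ Finset.range m, |a j| * ν n (v j) ≤ ν n x := by
    intro k hk n
    have h1 : a k • v k = x - ∑ j ∈ (Finset.range m).erase k, a j • v j := by
      rw [hx, ← Finset.add_sum_erase _ _ hk, add_sub_cancel_right]
    have h2 : ν n (a k • v k) ≤ ν n x + ∑ j ∈ (Finset.range m).erase k, |a j| * ν n (v j) := by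
      rw [h1]
      refine (map_sub_le_add _ _ _).trans (add_le_add le_rfl ?_)
      refine (Finset.le_sum_of_subadditive (ν n) (map_zero (ν n)).le (map_add_le_add _) _ _).trans
        (Finset.sum_le_sum fun j _ => ?_)
      rw [map_smul_eq_mul, Real.norm_eq_abs]
    rw [map_smul_eq_mul, Real.norm_eq_abs] at h2
    rw [← Finset.add_sum_erase _ _ hk]
    linarith
  have h1 : ∑ n ∈ Finset.range (N m), ν n x ≤ ∑' n, ν n x :=
    (hs x).sum_le_tsum _ fun _ _ => apply_nonneg _ _
  refine le_trans ?_ h1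
  rw [← hconc]
  have h2 : ∑ k ∈ Finset.range m, ∑ n ∈ Finset.Ico (N k) (N (k + 1)),
      (2 * (|a k| * ν n (v k)) - ∑ j ∈ Finset.range m, |a j| * ν n (v j)) ≤
      ∑ k ∈ Finset.range m, ∑ n ∈ Finset.Ico (N k) (N (k + 1)), ν n x :=
    Finset.sum_le_sum fun k hk => Finset.sum_le_sum fun n _ => hpoint k hk n
  refine le_trans ?_ h2
  simp only [Finset.sum_sub_distrib]
  rw [hconc, Finset.sum_comm (s := Finset.range (N m)), ← Finset.sum_sub_distrib, Finset.mul_sum]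
  refine Finset.sum_le_sum fun k _ => ?_
  rw [← Finset.mul_sum, ← Finset.mul_sum, ← Finset.mul_sum]
  have h3 : ∑' n, ν n (v k) ≤ ∑ n ∈ Finset.Ico (N k) (N (k + 1)), ν n (v k) + c / 4 := hf3 (S k)
  have h4 : ∑ n ∈ Finset.range (N m), ν n (v k) ≤ ∑' n, ν n (v k) :=
    (hs _).sum_le_tsum _ fun _ _ => apply_nonneg _ _
  have h5 : c ≤ ∑' n, ν n (v k) := hw _
  nlinarith [abs_nonneg (a k)]

theorem Ell1.summable_abs (a : Ell1) : Summable fun k => |a k| := by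
  simpa using (memℓp_gen_iff (p := 1) (by norm_num)).1 (lp.memℓp a)

theorem Ell1.norm_eq (a : Ell1) : ‖a‖ = ∑' k, |a k| := by
  simpa using lp.norm_eq_tsum_rpow (p := 1) (by norm_num) a

/-- A bounded sequence with a lower `ℓ₁` estimate spans a copy of `ℓ₁`. -/
theorem exists_isomorphicToEll1 {X : Type*} [NormedAddCommGroup X] [NormedSpace ℝ X]
    [CompleteSpace X] {Y : Submodule ℝ X} (hY : IsClosed (Y : Set X)) {w : ℕ → X}
    (hw : ∀ k, w k ∈ Y) {C c : ℝ} (hc : 0 < c) (hC : ∀ k, ‖w k‖ ≤ C)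
    (h : ∀ (m : ℕ) (a : ℕ → ℝ), c * ∑ k ∈ Finset.range m, |a k| ≤
      ‖∑ k ∈ Finset.range m, a k • w k‖) :
    ∃ Z : Submodule ℝ X, Z ≤ Y ∧ IsomorphicToEll1 Z := by
  have hsn : ∀ a : Ell1, Summable fun k => ‖a k • w k‖ := fun a => by
    refine Summable.of_nonneg_of_le (fun _ => norm_nonneg _) (fun k => ?_)
      ((Ell1.summable_abs a).mul_right C)
    rw [norm_smul, Real.norm_eq_abs]
    exact mul_le_mul_of_nonneg_left (hC k) (abs_nonneg _)
  have hsm : ∀ a : Ell1, Summable fun k => a k • w k := fun a => (hsn a).of_norm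
  let T : Ell1 →L[ℝ] X := LinearMap.mkContinuous
    { toFun := fun a => ∑' k, a k • w k
      map_add' := fun a b => by
        rw [← (hsm a).tsum_add (hsm b)]
        exact tsum_congr fun k => by rw [lp.coeFn_add, Pi.add_apply, add_smul]
      map_smul' := fun r a => by
        rw [RingHom.id_apply, ← (hsm a).tsum_const_smul]
        exact tsum_congr fun k => by rw [lp.coeFn_smul, Pi.smul_apply, smul_assoc] } C (fun a => by
      change ‖∑' k, a k • w k‖ ≤ C * ‖a‖
      rw [Ell1.norm_eq, ← tsum_mul_left]
      refine (norm_tsum_le_tsum_norm (hsn a)).trans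
        ((hsn a).tsum_le_tsum (fun k => ?_) ((Ell1.summable_abs a).mul_left C))
      rw [norm_smul, Real.norm_eq_abs, mul_comm]
      exact mul_le_mul_of_nonneg_right (hC k) (abs_nonneg _))
  have hT : ∀ a, Tendsto (fun m => ∑ k ∈ Finset.range m, a k • w k) atTop (𝓝 (T a)) := fun a =>
    (hsm a).hasSum.tendsto_sum_nat
  have hlow : ∀ a, c * ‖a‖ ≤ ‖T a‖ := fun a => by
    rw [Ell1.norm_eq]
    exact le_of_tendsto_of_tendsto' ((Ell1.summable_abs a).hasSum.tendsto_sum_nat.const_mul c)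
      (hT a).norm fun m => h m a
  have hanti : AntilipschitzWith (Real.toNNReal c⁻¹) T :=
    ContinuousLinearMap.antilipschitz_of_bound T fun a => by
      rw [Real.coe_toNNReal _ (inv_nonneg.2 hc.le), ← div_eq_inv_mul, le_div_iff₀ hc, mul_comm]
      exact hlow a
  refine ⟨LinearMap.range T.toLinearMap, ?_, ⟨?_⟩⟩
  · rintro _ ⟨a, rfl⟩
    exact hY.mem_of_tendsto (hT a) (Eventually.of_forall fun m =>
      Y.sum_mem fun k _ => Y.smul_mem _ (hw k))
  · exact (ContinuousLinearMap.equivRange hanti.injective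
      (hanti.isClosed_range T.uniformContinuous)).symm

/-! ### Schreier families -/

theorem empty_mem_schreier : ∀ n, (∅ : Finset ℕ+) ∈ schreier n
  | 0 => Or.inl rfl
  | n + 1 => ⟨1, fun _ => ∅, fun _ => empty_mem_schreier n, by simp, by simp [Before], by
      ext; simp⟩

/-- The pieces are the singletons of F in increasing order, with k = |F|. -/
theorem mem_schreier_one {F : Finset ℕ+} (h : ∀ a ∈ F, F.card ≤ (a : ℕ)) : F ∈ schreier 1 := by
  rcases F.eq_empty_or_nonempty with rfl | hF
  · exact empty_mem_schreier 1
  · refine ⟨⟨F.card, hF.card_pos⟩, fun i => {F.orderEmbOfFin rfl i}, fun i => Or.inr ⟨_, rfl⟩,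
      fun i a ha => ?_, fun i j hij a ha b hb => ?_, ?_⟩
    · rw [Finset.mem_singleton] at ha
      subst ha
      exact h _ (F.orderEmbOfFin_mem rfl i)
    · rw [Finset.mem_singleton] at ha hb
      subst ha hb
      exact (F.orderEmbOfFin rfl).strictMono hij
    · ext a
      have := F.range_orderEmbOfFin rfl
      simp only [Finset.mem_biUnion, Finset.mem_univ, true_and, Finset.mem_singleton]
      rw [← Finset.mem_coe, ← this]
      exact exists_congr fun _ => eq_comm

/-- A limit of members of `S_n` along an ultrafilter is a finite set. -/
theorem finite_limit_schreier (n : ℕ) : ∀ U : Ultrafilter (Finset ℕ+),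
    (∀ᶠ F in (U : Filter (Finset ℕ+)), F ∈ schreier n) →
    {j | ∀ᶠ F in (U : Filter (Finset ℕ+)), j ∈ F}.Finite := by
  induction n with
  | zero =>
    intro U hU
    refine Set.Subsingleton.finite fun i hi j hj => ?_
    obtain ⟨F, hF, hiF, hjF⟩ := (hU.and (Eventually.and hi hj)).exists
    rcases hF with rfl | ⟨k, rfl⟩
    · simp at hiF
    · rw [Finset.mem_singleton] at hiF hjF
      rw [hiF, hjF]
  | succ n ih =>
    intro U hU
    rcases Set.eq_empty_or_nonempty {j | ∀ᶠ F in (U : Filter (Finset ℕ+)), j ∈ F} with h | ⟨a, ha⟩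
    · rw [h]; exact Set.finite_empty
    -- A point a of the limit set belongs to almost every F and so bounds its number of pieces: k ≤
    -- a. The limit is thus covered by the limits of a sequences of pieces, padded by empty sets,
    -- and the ultrafilter commutes with this finite union.
    have key : ∀ F : Finset ℕ+, ∃ G : ℕ → Finset ℕ+, F ∈ schreier (n + 1) → a ∈ F →
        (∀ i, G i ∈ schreier n) ∧ ∀ j ∈ F, ∃ i ∈ Finset.range a, j ∈ G i := by
      intro F
      by_cases hF : F ∈ schreier (n + 1) ∧ a ∈ F
      · obtain ⟨⟨k, G, hG, hk, -, rfl⟩, haF⟩ := hF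
        refine ⟨fun i => if h : i < k then G ⟨i, h⟩ else ∅, fun _ _ => ⟨fun i => ?_, ?_⟩⟩
        · dsimp only
          split_ifs
          · exact hG _
          · exact empty_mem_schreier n
        · intro j hj
          obtain ⟨i, -, hi⟩ := Finset.mem_biUnion.1 hj
          obtain ⟨i', -, hi'⟩ := Finset.mem_biUnion.1 haF
          refine ⟨i, Finset.mem_range.2 (lt_of_lt_of_le i.2 (hk _ _ hi')), ?_⟩
          simpa using hi
      · exact ⟨fun _ => ∅, fun h1 h2 => absurd ⟨h1, h2⟩ hF⟩
    choose G hG using key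
    have hfin : ∀ i, {j | ∀ᶠ F in (U : Filter (Finset ℕ+)), j ∈ G F i}.Finite := fun i => by
      refine ih (U.map fun F => G F i) ?_
      change ∀ᶠ F in (U : Filter (Finset ℕ+)), G F i ∈ schreier n
      filter_upwards [hU, ha] with F hF haF
      exact (hG F hF haF).1 i
    refine ((Finset.range a).finite_toSet.biUnion fun i _ => hfin i).subset fun j hj => ?_
    have h1 : ∀ᶠ F in (U : Filter (Finset ℕ+)), ∃ i ∈ (Finset.range a : Set ℕ), j ∈ G F i := by
      filter_upwards [hU, ha, hj] with F hF haF hjF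
      simpa using (hG F hF haF).2 j hjF
    rw [Ultrafilter.eventually_exists_mem_iff (Finset.finite_toSet _)] at h1
    obtain ⟨i, hi, h⟩ := h1
    exact Set.mem_biUnion hi h

/-- The least element of a nonempty finite set. -/
def minOf (E : Finset ℕ+) : ℕ+ := if h : E.Nonempty then E.min' h else 1

theorem isLeast_minOf {E : Finset ℕ+} (h : E.Nonempty) : IsLeast (E : Set ℕ+) (minOf E) := by
  rw [minOf, dif_pos h]
  exact E.isLeast_min' h

theorem minOf_mem {E : Finset ℕ+} (h : E.Nonempty) : minOf E ∈ E := (isLeast_minOf h).1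

theorem minOf_le {E : Finset ℕ+} {j : ℕ+} (h : j ∈ E) : minOf E ≤ j := (isLeast_minOf ⟨j, h⟩).2 h

theorem minsInSchreier_iff {n : ℕ} {𝓔 : Finset (Finset ℕ+)} (h : ∀ E ∈ 𝓔, E.Nonempty) :
    MinsInSchreier n 𝓔 ↔ 𝓔.image minOf ∈ schreier n := by
  have h1 : {j | ∃ E ∈ 𝓔, IsLeast (E : Set ℕ+) j} = (𝓔.image minOf : Finset ℕ+) := by
    ext j
    simp only [mem_ofPred_eq, Finset.coe_image, Set.mem_image, Finset.mem_coe]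
    constructor
    · rintro ⟨E, hE, hj⟩
      exact ⟨E, hE, (isLeast_minOf (h E hE)).unique hj⟩
    · rintro ⟨E, hE, rfl⟩
      exact ⟨E, hE, isLeast_minOf (h E hE)⟩
  rw [MinsInSchreier, h1]
  constructor
  · rintro ⟨F, hF, he⟩
    rwa [← Finset.coe_injective he]
  · exact fun hF => ⟨_, hF, rfl⟩

theorem IsAllowable.injOn_minOf {n : ℕ} {𝓔 : Finset (Finset ℕ+)} (h : IsAllowable n 𝓔) :
    Set.InjOn minOf (𝓔 : Set (Finset ℕ+)) := fun E hE F hF he => by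
  by_contra hne
  exact Finset.disjoint_left.1 (h.disjoint E hE F hF hne) (minOf_mem (h.nonempty E hE))
    (he ▸ minOf_mem (h.nonempty F hF))

theorem Before.disjoint {E F : Finset ℕ+} (h : Before E F) : Disjoint E F :=
  Finset.disjoint_left.2 fun a haE haF => lt_irrefl _ (h a haE a haF)

theorem IsAdmissible.isAllowable {n : ℕ} {𝓔 : Finset (Finset ℕ+)} (h : IsAdmissible n 𝓔) :
    IsAllowable n 𝓔 :=
  ⟨h.nonempty, fun E hE F hF hne => (h.successive E hE F hF hne).elim Before.disjoint
    fun h' => h'.disjoint.symm, h.mins⟩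

/-! ### Restrictions -/

theorem restrict_apply (E : Finset ℕ+) (x : C00) (j : ℕ+) :
    restrict E x j = if j ∈ E then x j else 0 := Finsupp.filter_apply _ _ _

theorem restrict_restrict_comm (E F : Finset ℕ+) (x : C00) :
    restrict E (restrict F x) = restrict F (restrict E x) := by
  ext j
  simp only [restrict_apply]
  split_ifs <;> rfl

theorem restrict_eq_self {E : Finset ℕ+} {x : C00} (h : ∀ j, x j ≠ 0 → j ∈ E) :
    restrict E x = x := by
  ext j
  rw [restrict_apply]
  split_ifs with hj
  · rfl
  · by_contra h'
    exact hj (h j (Ne.symm h'))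

theorem restrict_eq_zero {E : Finset ℕ+} {x : C00} (h : ∀ j ∈ E, x j = 0) :
    restrict E x = 0 := by
  ext j
  rw [restrict_apply]
  split_ifs with hj
  · exact h j hj
  · rfl

theorem supNorm_restrict_le (E : Finset ℕ+) (x : C00) : supNorm (restrict E x) ≤ supNorm x :=
  ciSup_le fun j => by
    rw [restrict_apply]
    split_ifs
    · exact abs_le_supNorm x j
    · simpa using tame_supNorm.nonneg x

theorem Tame.zero {N : C00 → ℝ} (h : Tame N) : N 0 = 0 := by simpa using h.smul 0 0

theorem Tame.sum_le {N : C00 → ℝ} (h : Tame N) {ι : Type*} (s : Finset ι) (x : ι → C00) :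
    N (∑ k ∈ s, x k) ≤ ∑ k ∈ s, N (x k) :=
  Finset.le_sum_of_subadditive N h.zero.le h.add s x

theorem restrict_sum (E : Finset ℕ+) {ι : Type*} (s : Finset ι) (x : ι → C00) :
    restrict E (∑ k ∈ s, x k) = ∑ k ∈ s, restrict E (x k) := by
  classical
  induction s using Finset.induction_on with
  | empty => exact restrict_eq_zero (by simp)
  | insert a s ha ih =>
    rw [Finset.sum_insert ha, Finset.sum_insert ha, ← ih, restrict, Finsupp.filter_add]
    rfl

section

variable {θ : ℕ+ → ℝ} {A : ℕ+ → Set (Finset (Finset ℕ+))}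

theorem iterNorm_restrict_le (hθ : ∀ n, θ n ∈ Ioo (0 : ℝ) 1) (hA : DisjointFams A) (m : ℕ)
    (F : Finset ℕ+) : ∀ x, iterNorm θ A m (restrict F x) ≤ iterNorm θ A m x := by
  induction m with
  | zero => exact supNorm_restrict_le F
  | succ m ih =>
    intro x
    have ht := tame_iterNorm hθ hA
    refine step_le ((ht (m + 1)).nonneg x) ((supNorm_restrict_le F x).trans (le_max_left _ _))
      fun n 𝓔 h𝓔 => ?_
    refine le_trans ?_ (le_step hθ hA (ht m).le_l1 x h𝓔)
    refine mul_le_mul_of_nonneg_left (Finset.sum_le_sum fun E _ => ?_) (hθ n).1.le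
    rw [restrict_restrict_comm]
    exact ih _

theorem limNorm_restrict_le (hθ : ∀ n, θ n ∈ Ioo (0 : ℝ) 1) (hA : DisjointFams A)
    (F : Finset ℕ+) (x : C00) : limNorm θ A (restrict F x) ≤ limNorm θ A x :=
  ciSup_le fun m => (iterNorm_restrict_le hθ hA m F x).trans (iterNorm_le_limNorm hθ hA m x)

end

/-! ### The norming set -/

/-- The value at `|x|` of the functional with coefficients `f`. -/
def pairing (f : ℕ+ → ℝ) (x : C00) : ℝ := ∑ j ∈ x.support, f j * |x j|

theorem pairing_eq_sum (f : ℕ+ → ℝ) {x : C00} {s : Finset ℕ+} (h : x.support ⊆ s) :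
    pairing f x = ∑ j ∈ s, f j * |x j| := by
  refine Finset.sum_subset h fun j _ hj => ?_
  rw [Finsupp.notMem_support_iff.1 hj, abs_zero, mul_zero]

theorem support_restrict_subset (E : Finset ℕ+) (x : C00) :
    (restrict E x).support ⊆ x.support := by
  rw [restrict, Finsupp.support_filter]
  exact Finset.filter_subset _ _

theorem pairing_restrict {f : ℕ+ → ℝ} {E : Finset ℕ+} {x : C00}
    (h : ∀ j, j ∉ E → x j ≠ 0 → f j = 0) : pairing f (restrict E x) = pairing f x := by
  rw [pairing_eq_sum f (support_restrict_subset E x)]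
  refine Finset.sum_congr rfl fun j hj => ?_
  rw [restrict_apply]
  split_ifs with hjE
  · rfl
  · rw [h j hjE (Finsupp.mem_support_iff.1 hj)]
    simp

theorem pairing_smul (f : ℕ+ → ℝ) (c : ℝ) (x : C00) :
    pairing f (c • x) = |c| * pairing f x := by
  rw [pairing_eq_sum f Finsupp.support_smul, pairing, Finset.mul_sum]
  refine Finset.sum_congr rfl fun j _ => ?_
  rw [Finsupp.smul_apply, smul_eq_mul, abs_mul]
  ring

theorem pairing_nonneg {f : ℕ+ → ℝ} (hf : ∀ j, 0 ≤ f j) (x : C00) : 0 ≤ pairing f x :=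
  Finset.sum_nonneg fun j _ => mul_nonneg (hf j) (abs_nonneg _)

theorem pairing_add_le {f : ℕ+ → ℝ} (hf : ∀ j, 0 ≤ f j) (x y : C00) :
    pairing f (x + y) ≤ pairing f x + pairing f y := by
  classical
  rw [pairing_eq_sum f (x := x + y) Finsupp.support_add,
    pairing_eq_sum f (x := x) (Finset.subset_union_left (s₂ := y.support)),
    pairing_eq_sum f (x := y) (Finset.subset_union_right (s₁ := x.support)),
    ← Finset.sum_add_distrib]
  refine Finset.sum_le_sum fun j _ => ?_
  rw [← mul_add]
  exact mul_le_mul_of_nonneg_left (abs_add_le _ _) (hf j)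

theorem pairing_sum_left {ι : Type*} (s : Finset ι) (c : ℝ) (g : ι → ℕ+ → ℝ) (x : C00) :
    pairing (fun j => c * ∑ t ∈ s, g t j) x = c * ∑ t ∈ s, pairing (g t) x := by
  simp only [pairing]
  rw [Finset.sum_comm, Finset.mul_sum]
  refine Finset.sum_congr rfl fun j _ => ?_
  rw [mul_assoc, Finset.sum_mul]

theorem continuous_pairing (x : C00) : Continuous fun f : ℕ+ → ℝ => pairing f x := by
  unfold pairing
  fun_prop

/-- The (nonnegative) functionals which are used in the definition of the mixed Tsirelson norm. -/
inductive Norming (θ : ℕ+ → ℝ) (A : ℕ+ → Set (Finset (Finset ℕ+))) : (ℕ+ → ℝ) → Prop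
  | zero : Norming θ A 0
  | single (j : ℕ+) : Norming θ A (Pi.single j 1)
  | node (n : ℕ+) (𝓔 : Finset (Finset ℕ+)) (g : Finset ℕ+ → ℕ+ → ℝ) (h𝓔 : 𝓔 ∈ A n)
      (hg : ∀ E ∈ 𝓔, Norming θ A (g E)) (hs : ∀ E ∈ 𝓔, ∀ j, j ∉ E → g E j = 0) :
      Norming θ A fun j => θ n * ∑ E ∈ 𝓔, g E j

section

variable {θ : ℕ+ → ℝ} {A : ℕ+ → Set (Finset (Finset ℕ+))}

theorem Norming.nonneg (hθ : ∀ n, θ n ∈ Ioo (0 : ℝ) 1) {f : ℕ+ → ℝ} (hf : Norming θ A f) :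
    ∀ j, 0 ≤ f j := by
  induction hf with
  | zero => exact fun j => le_rfl
  | single i =>
    intro j
    by_cases h : j = i
    · subst h; simp
    · simp [h]
  | node n 𝓔 g h𝓔 hg hs ih =>
    exact fun j => mul_nonneg (hθ n).1.le (Finset.sum_nonneg fun E hE => ih E hE j)

theorem Norming.pairing_le (hθ : ∀ n, θ n ∈ Ioo (0 : ℝ) 1) (hA : DisjointFams A) {f : ℕ+ → ℝ}
    (hf : Norming θ A f) : ∀ x, pairing f x ≤ limNorm θ A x := by
  have hl := tame_limNorm hθ hA
  induction hf with
  | zero =>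
    intro x
    simpa [pairing] using hl.nonneg x
  | single i =>
    intro x
    have h1 : pairing (Pi.single i 1) x ≤ |x i| := by
      rw [pairing_eq_sum _ (Finset.subset_insert i x.support),
        Finset.sum_eq_single_of_mem i (Finset.mem_insert_self _ _)
          (fun j _ hj => by simp [hj])]
      simp
    exact h1.trans ((abs_le_supNorm x i).trans (iterNorm_le_limNorm hθ hA 0 x))
  | node n 𝓔 g h𝓔 hg hs ih =>
    intro x
    rw [pairing_sum_left, limNorm_eq_step hθ hA]
    refine le_trans ?_ (le_step hθ hA hl.le_l1 x h𝓔)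
    refine mul_le_mul_of_nonneg_left (Finset.sum_le_sum fun E hE => ?_) (hθ n).1.le
    rw [← pairing_restrict (E := E) fun j hj _ => hs E hE j hj]
    exact ih E hE _

theorem Norming.indicator {f : ℕ+ → ℝ} (hf : Norming θ A f) (S : Set ℕ+) :
    Norming θ A (S.indicator f) := by
  induction hf with
  | zero =>
    rw [Set.indicator_zero']
    exact .zero
  | single i =>
    by_cases h : i ∈ S
    · convert Norming.single (θ := θ) (A := A) i using 1
      refine Set.indicator_eq_self.2 fun j hj => ?_
      by_contra hjS
      have : j ≠ i := fun h' => hjS (h' ▸ h)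
      simp [this] at hj
    · convert Norming.zero (θ := θ) (A := A) using 1
      ext j
      by_cases hj : j ∈ S
      · have : j ≠ i := fun h' => h (h' ▸ hj)
        simp [hj, this]
      · simp [hj]
  | node n 𝓔 g h𝓔 hg hs ih =>
    convert Norming.node n 𝓔 (fun E => S.indicator (g E)) h𝓔 ih (fun E hE j hj => ?_) using 1
    · ext j
      by_cases hj : j ∈ S <;> simp [hj]
    · simp [hs E hE j hj]

/-- The suprema in the recursive definition are approximated level by level. At a node the error is
shared among the members of the family, and indicators cut the chosen functionals down to their
sets. -/
theorem exists_norming_lt (hθ : ∀ n, θ n ∈ Ioo (0 : ℝ) 1) (m : ℕ) :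
    ∀ (x : C00) {ε : ℝ}, 0 < ε → ∃ f, Norming θ A f ∧ iterNorm θ A m x ≤ pairing f x + ε := by
  have hsup : ∀ (x : C00) {ε : ℝ}, 0 < ε →
      ∃ f, Norming θ A f ∧ supNorm x ≤ pairing f x + ε := by
    intro x ε hε
    obtain ⟨j, hj⟩ := exists_lt_of_lt_ciSup (show supNorm x - ε < ⨆ j : ℕ+, |x j| by
      unfold supNorm; linarith)
    refine ⟨_, .single j, ?_⟩
    have h1 : |x j| ≤ pairing (Pi.single j 1) x := by
      rw [pairing_eq_sum _ (Finset.subset_insert j x.support),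
        Finset.sum_eq_single_of_mem j (Finset.mem_insert_self _ _)
          (fun j _ hj => by simp [hj])]
      simp
    linarith
  induction m with
  | zero => exact hsup
  | succ m ih =>
    intro x ε hε
    rcases le_or_gt (sSup (values θ A (iterNorm θ A m) x)) (supNorm x) with h | h
    · obtain ⟨f, hf, hx⟩ := hsup x hε
      exact ⟨f, hf, le_trans (max_le le_rfl h) hx⟩
    · have hne : (values θ A (iterNorm θ A m) x).Nonempty := by
        rw [Set.nonempty_iff_ne_empty]
        intro he
        rw [he, Real.sSup_empty] at h
        exact absurd h (not_lt.2 (tame_supNorm.nonneg x))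
      obtain ⟨_, ⟨n, 𝓔, h𝓔, rfl⟩, hr⟩ := exists_lt_of_lt_csSup hne
        (show sSup (values θ A (iterNorm θ A m) x) - ε / 2 < _ by linarith)
      have hδ : 0 < ε / 2 / (𝓔.card + 1) := by positivity
      choose f hf hfx using fun E : Finset ℕ+ => ih (restrict E x) hδ
      refine ⟨_, .node n 𝓔 (fun E => (E : Set ℕ+).indicator (f E)) h𝓔
        (fun E _ => (hf E).indicator _) (fun E _ j hj => by simp [hj]), ?_⟩
      have h1 : ∀ E ∈ 𝓔, iterNorm θ A m (restrict E x) ≤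
          pairing ((E : Set ℕ+).indicator (f E)) x + ε / 2 / (𝓔.card + 1) := by
        intro E _
        refine (hfx E).trans (add_le_add (le_of_eq ?_) le_rfl)
        rw [← pairing_restrict (f := (E : Set ℕ+).indicator (f E)) (E := E)
          (fun j hj _ => by simp [hj])]
        refine Finset.sum_congr rfl fun j hj => ?_
        have hjE : j ∈ E := by
          by_contra hjE
          rw [Finsupp.mem_support_iff, restrict_apply, if_neg hjE] at hj
          exact hj rfl
        rw [Set.indicator_of_mem (by simpa using hjE)]
      have h2 := Finset.sum_le_sum h1
      rw [Finset.sum_add_distrib, Finset.sum_const, nsmul_eq_mul] at h2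
      have h3 : (𝓔.card : ℝ) * (ε / 2 / (𝓔.card + 1)) ≤ ε / 2 := by
        rw [← mul_div_assoc, div_le_iff₀ (by positivity)]
        nlinarith
      have h4 := mul_le_mul_of_nonneg_left (h2.trans (add_le_add le_rfl h3)) (hθ n).1.le
      rw [mul_add] at h4
      have h5 : θ n * (ε / 2) ≤ ε / 2 := by nlinarith [(hθ n).2]
      rw [pairing_sum_left]
      have h6 : iterNorm θ A (m + 1) x = sSup (values θ A (iterNorm θ A m) x) :=
        max_eq_right h.le
      linarith

theorem limNorm_le_of_norming (hθ : ∀ n, θ n ∈ Ioo (0 : ℝ) 1) {x : C00} {b : ℝ}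
    (h : ∀ f, Norming θ A f → pairing f x ≤ b) : limNorm θ A x ≤ b := by
  refine ciSup_le fun m => le_of_forall_pos_le_add fun ε hε => ?_
  obtain ⟨f, hf, hx⟩ := exists_norming_lt (A := A) hθ m x hε
  linarith [h f hf]

end

/-! ### Pointwise limits of norming functionals -/

section

variable {θ : ℕ+ → ℝ} {A : ℕ+ → Set (Finset (Finset ℕ+))}

/-- The pointwise closure of the norming set. -/
def normingClosure (θ : ℕ+ → ℝ) (A : ℕ+ → Set (Finset (Finset ℕ+))) : Set (ℕ+ → ℝ) :=
  closure {f | Norming θ A f}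

theorem nonneg_of_mem_normingClosure (hθ : ∀ n, θ n ∈ Ioo (0 : ℝ) 1) {f : ℕ+ → ℝ}
    (hf : f ∈ normingClosure θ A) (j : ℕ+) : 0 ≤ f j :=
  closure_minimal (t := {f : ℕ+ → ℝ | 0 ≤ f j}) (fun _ hg => Norming.nonneg hθ hg j)
    (isClosed_le continuous_const (continuous_apply j)) hf

theorem pairing_le_of_mem_normingClosure (hθ : ∀ n, θ n ∈ Ioo (0 : ℝ) 1) (hA : DisjointFams A)
    {f : ℕ+ → ℝ} (hf : f ∈ normingClosure θ A) (x : C00) : pairing f x ≤ limNorm θ A x :=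
  closure_minimal (t := {f : ℕ+ → ℝ | pairing f x ≤ limNorm θ A x})
    (fun _ hg => Norming.pairing_le hθ hA hg x)
    (isClosed_le (continuous_pairing x) continuous_const) hf

theorem pairing_single (f : ℕ+ → ℝ) (j : ℕ+) : pairing f (Finsupp.single j 1) = f j := by
  rw [pairing_eq_sum f (s := {j}) Finsupp.support_single_subset]
  simp

theorem l1Norm_single (j : ℕ+) : l1Norm (Finsupp.single j 1) = 1 := by
  rw [l1Norm, Finsupp.support_single _ one_ne_zero]
  simp

theorem le_one_of_mem_normingClosure (hθ : ∀ n, θ n ∈ Ioo (0 : ℝ) 1) (hA : DisjointFams A)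
    {f : ℕ+ → ℝ} (hf : f ∈ normingClosure θ A) (j : ℕ+) : f j ≤ 1 := by
  rw [← pairing_single f j]
  refine le_trans ?_ (l1Norm_single j).le
  exact (pairing_le_of_mem_normingClosure hθ hA hf _).trans ((tame_limNorm hθ hA).le_l1 _)

theorem isCompact_normingClosure (hθ : ∀ n, θ n ∈ Ioo (0 : ℝ) 1) (hA : DisjointFams A) :
    IsCompact (normingClosure θ A) :=
  (isCompact_univ_pi fun _ : ℕ+ => isCompact_Icc (a := (0 : ℝ)) (b := 1)).of_isClosed_subset
    isClosed_closure fun _ hf j _ =>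
      ⟨nonneg_of_mem_normingClosure hθ hf j, le_one_of_mem_normingClosure hθ hA hf j⟩

/-- `f` is `θ n ∑_{j ∈ F} h j` for norming functionals `h j` with disjoint supports whose minima
lie above `j`, where `F` belongs to `S_n`. -/
structure HasComponents (θ : ℕ+ → ℝ) (A : ℕ+ → Set (Finset (Finset ℕ+))) (f : ℕ+ → ℝ) (n : ℕ+)
    (F : Finset ℕ+) (h : ℕ+ → ℕ+ → ℝ) : Prop where
  mem : F ∈ schreier n
  norming : ∀ j, Norming θ A (h j)
  zero : ∀ j, j ∉ F → h j = 0
  above : ∀ j i, i < j → h j i = 0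
  disjoint : ∀ j j', j ≠ j' → ∀ i, h j i = 0 ∨ h j' i = 0
  eq : ∀ i, f i = θ n * ∑ j ∈ Finset.Iic i, h j i

/-- The sets of an allowable family have distinct minima, so its functionals can be indexed by these
minima. Indexing by points of a Schreier set, not by sets, is what permits limits of each component
separately. -/
theorem exists_hasComponents (hA : ∀ n, ∀ 𝓔 ∈ A n, IsAllowable n 𝓔) {n : ℕ+}
    {𝓔 : Finset (Finset ℕ+)} {g : Finset ℕ+ → ℕ+ → ℝ} (h𝓔 : 𝓔 ∈ A n)
    (hg : ∀ E ∈ 𝓔, Norming θ A (g E)) (hs : ∀ E ∈ 𝓔, ∀ j, j ∉ E → g E j = 0) :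
    ∃ F h, HasComponents θ A (fun j => θ n * ∑ E ∈ 𝓔, g E j) n F h := by
  classical
  have hall := hA n 𝓔 h𝓔
  have hinj := hall.injOn_minOf
  let h : ℕ+ → ℕ+ → ℝ := fun j =>
    if hj : ∃ E ∈ 𝓔, minOf E = j then g hj.choose else 0
  have hh : ∀ E ∈ 𝓔, h (minOf E) = g E := by
    intro E hE
    have hj : ∃ E' ∈ 𝓔, minOf E' = minOf E := ⟨E, hE, rfl⟩
    simp only [h, dif_pos hj]
    rw [hinj hj.choose_spec.1 hE hj.choose_spec.2]
  have hcases : ∀ j, (∃ E ∈ 𝓔, minOf E = j) ∨ (j ∉ 𝓔.image minOf ∧ h j = 0) := by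
    intro j
    by_cases hj : ∃ E ∈ 𝓔, minOf E = j
    · exact Or.inl hj
    · exact Or.inr ⟨by simpa using hj, by simp only [h, dif_neg hj]⟩
  have habove : ∀ j i, i < j → h j i = 0 := by
    intro j i hij
    rcases hcases j with ⟨E, hE, rfl⟩ | ⟨-, h0⟩
    · rw [hh E hE]
      exact hs E hE i fun hi => absurd (minOf_le hi) (not_le.2 hij)
    · rw [h0, Pi.zero_apply]
  refine ⟨𝓔.image minOf, h, (minsInSchreier_iff hall.nonempty).1 hall.mins, fun j => ?_,
    fun j hj => ?_, habove, fun j j' hne i => ?_, fun i => ?_⟩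
  · rcases hcases j with ⟨E, hE, rfl⟩ | ⟨-, h0⟩
    · rw [hh E hE]; exact hg E hE
    · rw [h0]; exact .zero
  · rcases hcases j with ⟨E, hE, rfl⟩ | ⟨-, h0⟩
    · exact absurd (Finset.mem_image_of_mem _ hE) hj
    · exact h0
  · rcases hcases j with ⟨E, hE, rfl⟩ | ⟨-, h0⟩
    · rcases hcases j' with ⟨E', hE', rfl⟩ | ⟨-, h0'⟩
      · rw [hh E hE, hh E' hE']
        have hd := hall.disjoint E hE E' hE' fun he => hne (by rw [he])
        by_cases hi : i ∈ E
        · exact Or.inr (hs E' hE' i (Finset.disjoint_left.1 hd hi))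
        · exact Or.inl (hs E hE i hi)
      · exact Or.inr (by rw [h0', Pi.zero_apply])
    · exact Or.inl (by rw [h0, Pi.zero_apply])
  · have h1 : ∑ E ∈ 𝓔, g E i = ∑ j ∈ 𝓔.image minOf, h j i := by
      rw [Finset.sum_image hinj]
      exact Finset.sum_congr rfl fun E hE => by rw [hh E hE]
    rw [h1, Finset.sum_subset (Finset.subset_union_left (s₂ := Finset.Iic i)),
      ← Finset.sum_subset (Finset.subset_union_right (s₁ := 𝓔.image minOf))]
    · intro j _ hj
      exact habove j i (by simpa using hj)
    · intro j _ hj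
      rcases hcases j with ⟨E, hE, rfl⟩ | ⟨-, h0⟩
      · exact absurd (Finset.mem_image_of_mem _ hE) hj
      · rw [h0, Pi.zero_apply]

/-- A pointwise limit of norming functionals is, up to finitely many coordinates, a multiple of a
sum of finitely many such limits with disjoint supports. -/
theorem exists_decomposition (hθ : ∀ n, θ n ∈ Ioo (0 : ℝ) 1) (hθ0 : Tendsto θ atTop (𝓝 0))
    (hA : ∀ n, ∀ 𝓔 ∈ A n, IsAllowable n 𝓔) {Θ : ℝ} (hΘ : ∀ n, θ n ≤ Θ)
    {f : ℕ+ → ℝ} (hf : f ∈ normingClosure θ A) :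
    ∃ (c : ℝ) (F : Finset ℕ+) (h : ℕ+ → ℕ+ → ℝ) (N : ℕ+), c ≤ Θ ∧
      (∀ j, h j ∈ normingClosure θ A) ∧
      (∀ j j', j ≠ j' → ∀ i, h j i = 0 ∨ h j' i = 0) ∧
      (∀ j ∈ F, ∀ i, h j i ≠ 0 → f i ≠ 0) ∧
      ∀ i, N < i → f i = c * ∑ j ∈ F, h j i := by
  classical
  have hAd : DisjointFams A := fun n 𝓔 h => (hA n 𝓔 h).disjoint
  have hzero : (0 : ℕ+ → ℝ) ∈ normingClosure θ A := subset_closure Norming.zero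
  have hfin : (∃ N, ∀ i, N < i → f i = 0) → _ := fun ⟨N, hN⟩ =>
    (⟨Θ, ∅, fun _ => 0, N, le_rfl, fun _ => hzero, fun _ _ _ _ => Or.inl rfl, by simp,
      fun i hi => by simp [hN i hi]⟩ : ∃ (c : ℝ) (F : Finset ℕ+) (h : ℕ+ → ℕ+ → ℝ) (N : ℕ+), c ≤ Θ ∧
      (∀ j, h j ∈ normingClosure θ A) ∧
      (∀ j j', j ≠ j' → ∀ i, h j i = 0 ∨ h j' i = 0) ∧
      (∀ j ∈ F, ∀ i, h j i ≠ 0 → f i ≠ 0) ∧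
      ∀ i, N < i → f i = c * ∑ j ∈ F, h j i)
  by_cases hf0 : f = 0
  · exact hfin ⟨1, fun i _ => by rw [hf0, Pi.zero_apply]⟩
  obtain ⟨j0, hj0⟩ := Function.ne_iff.1 hf0
  have hpos : 0 < f j0 := lt_of_le_of_ne (nonneg_of_mem_normingClosure hθ hf j0) (Ne.symm hj0)
  obtain ⟨U, hUK, hUf⟩ := mem_closure_iff_ultrafilter.1 hf
  have hlim : ∀ i, Tendsto (fun g : ℕ+ → ℝ => g i) U (𝓝 (f i)) := fun i =>
    ((continuous_apply i).tendsto f).mono_left hUf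
  have hbig : ∀ᶠ g in (U : Filter (ℕ+ → ℝ)), f j0 / 2 < g j0 :=
    (hlim j0).eventually (lt_mem_nhds (by linarith))
  have hUK' : ∀ᶠ g in (U : Filter (ℕ+ → ℝ)), Norming θ A g := hUK
  -- A node of weight θ n takes values at most θ n, so functionals with value above f j0 / 2 at j0
  -- use only finitely many n; the ultrafilter then selects one of them.
  have hS : {n : ℕ+ | f j0 / 2 < θ n}.Finite := by
    obtain ⟨n0, hn0⟩ := eventually_atTop.1 (hθ0.eventually (gt_mem_nhds (half_pos hpos)))
    refine (Set.finite_Iio n0).subset fun n hn => ?_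
    by_contra hle
    exact lt_asymm hn (hn0 n (not_lt.1 hle))
  have hdich : ∀ᶠ g in (U : Filter (ℕ+ → ℝ)), g = Pi.single j0 1 ∨
      ∃ n ∈ {n : ℕ+ | f j0 / 2 < θ n}, ∃ F h, HasComponents θ A g n F h := by
    filter_upwards [hbig, hUK'] with g hg hgN
    cases hgN with
    | zero => simp only [Pi.zero_apply] at hg; linarith
    | single j =>
      left
      by_cases h : j0 = j
      · rw [h]
      · simp [h] at hg; linarith
    | node n 𝓔 g h𝓔 hgE hs =>
      refine Or.inr ⟨n, ?_, exists_hasComponents hA h𝓔 hgE hs⟩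
      have h1 : ∑ E ∈ 𝓔, g E j0 ≤ 1 := by
        rw [← l1Norm_single j0]
        refine le_trans (Finset.sum_le_sum fun E hE => ?_) (sum_l1Norm_restrict_le 𝓔
          (hAd n 𝓔 h𝓔) _)
        rw [← pairing_single (g E) j0,
          ← pairing_restrict (E := E) fun j hj _ => hs E hE j hj]
        exact ((hgE E hE).pairing_le hθ hAd _).trans ((tame_limNorm hθ hAd).le_l1 _)
      have h2 := mul_le_mul_of_nonneg_left h1 (hθ n).1.le
      change f j0 / 2 < θ n
      linarith
  rcases Ultrafilter.eventually_or.1 hdich with hsing | hnode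
  · refine hfin ⟨j0, fun i hi => ?_⟩
    refine tendsto_nhds_unique (hlim i) (tendsto_const_nhds.congr' ?_)
    filter_upwards [hsing] with g hg
    rw [hg, Pi.single_eq_of_ne hi.ne']
  rw [Ultrafilter.eventually_exists_mem_iff hS] at hnode
  obtain ⟨n, -, hn⟩ := hnode
  have hch : ∀ g : ℕ+ → ℝ, ∃ F h, (∃ F h, HasComponents θ A g n F h) →
      HasComponents θ A g n F h := fun g => by
    by_cases h : ∃ F h, HasComponents θ A g n F h
    · obtain ⟨F, h', hc⟩ := h
      exact ⟨F, h', fun _ => hc⟩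
    · exact ⟨∅, 0, fun h' => absurd h' h⟩
  choose F h hFh using hch
  have hcomp : ∀ᶠ g in (U : Filter (ℕ+ → ℝ)), HasComponents θ A g n (F g) (h g) := by
    filter_upwards [hn] with g hg using hFh g hg
  have hL : ∀ j, ∃ L ∈ normingClosure θ A, Tendsto (fun g => h g j) U (𝓝 L) := by
    intro j
    obtain ⟨L, hL, hUL⟩ := (isCompact_normingClosure hθ hAd).ultrafilter_le_nhds
      (U.map fun g => h g j) (by
        rw [le_principal_iff]
        change ∀ᶠ g in (U : Filter (ℕ+ → ℝ)), h g j ∈ normingClosure θ A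
        filter_upwards [hcomp] with g hg using subset_closure (hg.norming j))
    exact ⟨L, hL, hUL⟩
  choose L hLK hLlim using hL
  have hLlim' : ∀ j i, Tendsto (fun g => h g j i) U (𝓝 (L j i)) := fun j i =>
    ((continuous_apply i).tendsto (L j)).comp (hLlim j)
  -- Only the finitely many j in the limit of the index sets can carry a nonzero limit component.
  have hFfin : {j | ∀ᶠ g in (U : Filter (ℕ+ → ℝ)), j ∈ F g}.Finite :=
    finite_limit_schreier n (U.map F) (by
      change ∀ᶠ g in (U : Filter (ℕ+ → ℝ)), F g ∈ schreier n
      filter_upwards [hcomp] with g hg using hg.mem)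
  have hLzero : ∀ j, j ∉ hFfin.toFinset → ∀ i, L j i = 0 := by
    intro j hj i
    have hj' : ∀ᶠ g in (U : Filter (ℕ+ → ℝ)), j ∉ F g := by
      rw [Ultrafilter.eventually_not]
      simpa using hj
    refine tendsto_nhds_unique (hLlim' j i) (tendsto_const_nhds.congr' ?_)
    filter_upwards [hj', hcomp] with g hg hgc
    rw [hgc.zero j hg, Pi.zero_apply]
  have hLabove : ∀ j i, i < j → L j i = 0 := by
    intro j i hij
    refine tendsto_nhds_unique (hLlim' j i) (tendsto_const_nhds.congr' ?_)
    filter_upwards [hcomp] with g hgc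
    rw [hgc.above j i hij]
  have hLdisj : ∀ j j', j ≠ j' → ∀ i, L j i = 0 ∨ L j' i = 0 := by
    intro j j' hne i
    rw [← mul_eq_zero]
    refine tendsto_nhds_unique ((hLlim' j i).mul (hLlim' j' i)) (tendsto_const_nhds.congr' ?_)
    filter_upwards [hcomp] with g hgc
    exact (mul_eq_zero.2 (hgc.disjoint j j' hne i)).symm
  have heq : ∀ i, f i = θ n * ∑ j ∈ hFfin.toFinset, L j i := by
    intro i
    -- The index set `F g` varies with g, but at the coordinate i only components j ≤ i can
    -- contribute; over this fixed finite set limits pass through the sum.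
    have h1 : f i = θ n * ∑ j ∈ Finset.Iic i, L j i := by
      refine tendsto_nhds_unique (hlim i) (((tendsto_finsetSum (Finset.Iic i)
        fun j _ => hLlim' j i).const_mul (θ n)).congr' ?_)
      filter_upwards [hcomp] with g hgc
      rw [hgc.eq i]
    rw [h1, Finset.sum_subset (Finset.subset_union_left (s₂ := hFfin.toFinset)),
      ← Finset.sum_subset (Finset.subset_union_right (s₁ := Finset.Iic i))]
    · exact fun j _ hj => hLzero j hj i
    · exact fun j _ hj => hLabove j i (by simpa using hj)
  refine ⟨θ n, hFfin.toFinset, L, 1, hΘ n, hLK, hLdisj, fun j hj i hji => ?_, fun i _ => heq i⟩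
  rw [heq i]
  refine (mul_pos (hθ n).1 (Finset.sum_pos' (fun j' _ => nonneg_of_mem_normingClosure hθ (hLK j') i)
    ⟨j, hj, lt_of_le_of_ne (nonneg_of_mem_normingClosure hθ (hLK j) i) (Ne.symm hji)⟩)).ne'

theorem isAllowable_one {𝓔 : Finset (Finset ℕ+)} (hne : ∀ E ∈ 𝓔, E.Nonempty)
    (hd : ∀ E ∈ 𝓔, ∀ F ∈ 𝓔, E ≠ F → Disjoint E F) (hc : ∀ E ∈ 𝓔, ∀ a ∈ E, 𝓔.card ≤ (a : ℕ)) :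
    IsAllowable 1 𝓔 := by
  refine ⟨hne, hd, (minsInSchreier_iff hne).2 (mem_schreier_one fun a ha => ?_)⟩
  obtain ⟨E, hE, rfl⟩ := Finset.mem_image.1 ha
  exact Finset.card_image_le.trans (hc E hE _ (minOf_mem (hne E hE)))

/-- Each decomposition replaces the family by another finite disjoint family, at the cost of moving
N, and gains a factor Θ. Finite families instead of a single f are needed for this induction. The
factor θ 1 is paid only once, at m = 0. -/
theorem exists_tail_estimate (hθ : ∀ n, θ n ∈ Ioo (0 : ℝ) 1) (hθ0 : Tendsto θ atTop (𝓝 0))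
    (hA : ∀ n, ∀ 𝓔 ∈ A n, IsAllowable n 𝓔) (hA1 : ∀ 𝓔, IsAllowable 1 𝓔 → 𝓔 ∈ A 1)
    {Θ : ℝ} (hΘ0 : 0 < Θ) (hΘ : ∀ n, θ n ≤ Θ) (m : ℕ) :
    ∀ (ι : Type) [Fintype ι] (f : ι → ℕ+ → ℝ), (∀ t, f t ∈ normingClosure θ A) →
      (∀ t t', t ≠ t' → ∀ i, f t i = 0 ∨ f t' i = 0) →
      ∃ N : ℕ+, ∀ x : C00, (∀ j ≤ N, x j = 0) →
        θ 1 * ∑ t, pairing (f t) x ≤ Θ ^ m * limNorm θ A x := by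
  classical
  have hAd : DisjointFams A := fun n 𝓔 h => (hA n 𝓔 h).disjoint
  have hl := tame_limNorm hθ hAd
  induction m with
  | zero =>
    intro ι _ f hf hdis
    -- There are at most |ι| disjoint supports and all their points exceed |ι|, so they form an
    -- S_1-allowable family. They may interlace, hence allowable and not admissible families are
    -- needed for n = 1.
    refine ⟨Nat.succPNat (Fintype.card ι), fun x hx => ?_⟩
    let E : ι → Finset ℕ+ := fun t => x.support.filter fun j => f t j ≠ 0
    let T : Finset ι := Finset.univ.filter fun t => (E t).Nonempty
    have hE : ∀ t j, j ∈ E t ↔ x j ≠ 0 ∧ f t j ≠ 0 := fun t j => by simp [E]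
    have hEd : ∀ t t', t ≠ t' → Disjoint (E t) (E t') := fun t t' hne =>
      Finset.disjoint_left.2 fun j hj hj' =>
        (hdis t t' hne j).elim ((hE t j).1 hj).2 ((hE t' j).1 hj').2
    have hinj : Set.InjOn E (T : Set ι) := by
      intro t ht t' _ he
      by_contra hne
      obtain ⟨j, hj⟩ := (Finset.mem_filter.1 ht).2
      exact Finset.disjoint_left.1 (hEd t t' hne) hj (he ▸ hj)
    have hall : IsAllowable 1 (T.image E) := by
      refine isAllowable_one ?_ ?_ ?_
      · simp [T]
      · rintro _ h1 _ h2 hne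
        obtain ⟨t, -, rfl⟩ := Finset.mem_image.1 h1
        obtain ⟨t', -, rfl⟩ := Finset.mem_image.1 h2
        exact hEd t t' fun he => hne (by rw [he])
      · rintro _ h1 a ha
        obtain ⟨t, -, rfl⟩ := Finset.mem_image.1 h1
        have h2 : (T.image E).card ≤ Fintype.card ι :=
          Finset.card_image_le.trans (Finset.card_le_univ T)
        by_contra! hlt
        refine ((hE t a).1 ha).1 (hx a ?_)
        rw [← PNat.coe_le_coe, Nat.succPNat_coe]
        lia
    rw [pow_zero, one_mul, limNorm_eq_step hθ hAd]
    refine le_trans ?_ (le_step hθ hAd hl.le_l1 x (hA1 _ hall))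
    refine mul_le_mul_of_nonneg_left ?_ (hθ 1).1.le
    rw [Finset.sum_image hinj]
    have hpr : ∀ t, pairing (f t) x = pairing (f t) (restrict (E t) x) := fun t =>
      (pairing_restrict fun j hj hxj => by
        by_contra h
        exact hj ((hE t j).2 ⟨hxj, h⟩)).symm
    rw [← Finset.sum_subset (Finset.subset_univ T)]
    · refine Finset.sum_le_sum fun t _ => ?_
      rw [hpr t]
      exact pairing_le_of_mem_normingClosure hθ hAd (hf t) _
    · intro t _ ht
      have h1 : E t = ∅ := by simpa [T] using ht
      rw [hpr t, h1, restrict_eq_zero (by simp)]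
      simp [pairing]
  | succ m ih =>
    intro ι _ f hf hdis
    choose c F h N hc hh hhd hhs heq using
      fun t => exists_decomposition hθ hθ0 hA hΘ (hf t)
    -- Components of different f t are disjoint because each is supported inside the support of its
    -- own f t.
    obtain ⟨N', hN'⟩ := ih (Σ t : ι, {j // j ∈ F t}) (fun p => h p.1 p.2) (fun p => hh _ _) (by
      rintro ⟨t, j, hj⟩ ⟨t', j', hj'⟩ hne i
      by_cases htt : t = t'
      · subst htt
        refine hhd t j j' (fun hjj => hne ?_) i
        subst hjj
        rfl
      · by_contra! hcon
        exact (hdis t t' htt i).elim (hhs t j hj i hcon.1) (hhs t' j' hj' i hcon.2))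
    obtain ⟨M, hM⟩ := (insert N' (Finset.univ.image N)).exists_le
    refine ⟨M, fun x hx => ?_⟩
    have hN'M : N' ≤ M := hM _ (Finset.mem_insert_self _ _)
    have hNM : ∀ t, N t ≤ M := fun t => hM _ (Finset.mem_insert_of_mem
      (Finset.mem_image_of_mem _ (Finset.mem_univ t)))
    have h1 := hN' x fun j hj => hx j (hj.trans hN'M)
    rw [Fintype.sum_sigma] at h1
    have h2 : ∀ t, pairing (f t) x ≤ Θ * ∑ j : {j // j ∈ F t}, pairing (h t j) x := by
      intro t
      have h3 : pairing (f t) x = c t * ∑ j ∈ F t, pairing (h t j) x := by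
        rw [← pairing_sum_left]
        refine Finset.sum_congr rfl fun i hi => ?_
        rw [heq t i]
        by_contra hle
        exact (Finsupp.mem_support_iff.1 hi) (hx i ((not_lt.1 hle).trans (hNM t)))
      rw [h3, Finset.sum_coe_sort (F t) (fun j => pairing (h t j) x)]
      exact mul_le_mul_of_nonneg_right (hc t) (Finset.sum_nonneg fun j _ =>
        pairing_nonneg (nonneg_of_mem_normingClosure hθ (hh t j)) x)
    have h3 : θ 1 * ∑ t, pairing (f t) x ≤
        θ 1 * ∑ t, Θ * ∑ j : {j // j ∈ F t}, pairing (h t j) x :=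
      mul_le_mul_of_nonneg_left (Finset.sum_le_sum fun t _ => h2 t) (hθ 1).1.le
    refine h3.trans ?_
    rw [← Finset.mul_sum, mul_left_comm, pow_succ', mul_assoc]
    exact mul_le_mul_of_nonneg_left h1 hΘ0.le

theorem exists_sup_lt_one {θ : ℕ+ → ℝ} (hθ : ∀ n, θ n ∈ Ioo (0 : ℝ) 1)
    (hθ0 : Tendsto θ atTop (𝓝 0)) : ∃ Θ : ℝ, 0 < Θ ∧ Θ < 1 ∧ ∀ n, θ n ≤ Θ := by
  obtain ⟨n0, hn0⟩ := eventually_atTop.1 (hθ0.eventually (gt_mem_nhds (hθ 1).1))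
  have hne : (Finset.Iic n0).Nonempty := ⟨1, by simp⟩
  obtain ⟨k, -, hk⟩ := (Finset.Iic n0).exists_max_image θ hne
  refine ⟨θ k, (hθ k).1, (hθ k).2, fun n => ?_⟩
  rcases le_total n n0 with h | h
  · exact hk n (by simpa using h)
  · exact (hn0 n h).le.trans (hk 1 (by simp))

/-- A bounded coordinatewise null sequence is pointwise null on the closure of the norming set. -/
theorem tendsto_pairing (hθ : ∀ n, θ n ∈ Ioo (0 : ℝ) 1) (hθ0 : Tendsto θ atTop (𝓝 0))
    (hA : ∀ n, ∀ 𝓔 ∈ A n, IsAllowable n 𝓔) (hA1 : ∀ 𝓔, IsAllowable 1 𝓔 → 𝓔 ∈ A 1)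
    {u : ℕ → C00} {C : ℝ} (hu : ∀ k, limNorm θ A (u k) ≤ C)
    (hu0 : ∀ j, Tendsto (fun k => u k j) atTop (𝓝 0)) {f : ℕ+ → ℝ}
    (hf : f ∈ normingClosure θ A) : Tendsto (fun k => pairing f (u k)) atTop (𝓝 0) := by
  classical
  have hAd : DisjointFams A := fun n 𝓔 h => (hA n 𝓔 h).disjoint
  have hf0 := nonneg_of_mem_normingClosure hθ hf
  obtain ⟨Θ, hΘ0, hΘ1, hΘ⟩ := exists_sup_lt_one hθ hθ0
  have hC : 0 ≤ C := ((tame_limNorm hθ hAd).nonneg (u 0)).trans (hu 0)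
  rw [Metric.tendsto_atTop']
  refine fun ε hε => eventually_atTop.1 ?_ |>.imp fun n hn k hk => hn k hk.le
  have hm : Tendsto (fun m => Θ ^ m * C) atTop (𝓝 0) := by
    simpa using (tendsto_pow_atTop_nhds_zero_of_lt_one hΘ0.le hΘ1).mul_const C
  -- With this m the tail of u k beyond N pairs with f to less than ε/2; the finitely many remaining
  -- coordinates tend to 0.
  obtain ⟨m, hm⟩ := (hm.eventually (gt_mem_nhds
    (show 0 < θ 1 * (ε / 2) from mul_pos (hθ 1).1 (half_pos hε)))).exists
  obtain ⟨N, hN⟩ := exists_tail_estimate hθ hθ0 hA hA1 hΘ0 hΘ m Unit (fun _ => f)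
    (fun _ => hf) (fun t t' h => absurd (Subsingleton.elim t t') h)
  have hsum : Tendsto (fun k => ∑ j ∈ Finset.Iic N, f j * |u k j|) atTop (𝓝 0) := by
    simpa using tendsto_finsetSum (Finset.Iic N) fun j _ => ((hu0 j).abs.const_mul (f j))
  filter_upwards [hsum.eventually (gt_mem_nhds (half_pos hε))] with k hk
  rw [Real.dist_0_eq_abs, abs_of_nonneg (pairing_nonneg hf0 _)]
  set x := u k with hx
  set E := x.support.filter (N < ·) with hE
  have h1 : pairing f x ≤ ∑ j ∈ Finset.Iic N, f j * |x j| + pairing f (restrict E x) := by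
    have h5 : x = restrict (Finset.Iic N) x + restrict E x := by
      ext j
      rw [Finsupp.add_apply, restrict_apply, restrict_apply]
      by_cases hj : j ≤ N
      · simp [hE, hj]
      · by_cases hxj : x j = 0 <;> simp [hE, hj, hxj, not_le.1 hj]
    nth_rewrite 1 [h5]
    refine (pairing_add_le hf0 _ _).trans (add_le_add ?_ le_rfl)
    rw [pairing_eq_sum f (s := Finset.Iic N) fun j hj => ?_]
    · refine Finset.sum_le_sum fun j hj => ?_
      rw [restrict_apply, if_pos hj]
    · by_contra hjN
      rw [Finsupp.mem_support_iff, restrict_apply, if_neg hjN] at hj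
      exact hj rfl
  have h2 := hN (restrict E x) fun j hj => by
    rw [restrict_apply, if_neg]
    simp only [hE, Finset.mem_filter, not_and, not_lt]
    exact fun _ => hj
  rw [Finset.univ_unique, Finset.sum_singleton] at h2
  have h3 : Θ ^ m * limNorm θ A (restrict E x) ≤ Θ ^ m * C :=
    mul_le_mul_of_nonneg_left ((limNorm_restrict_le hθ hAd E x).trans (hu k)) (by positivity)
  have h4 : pairing f (restrict E x) < ε / 2 :=
    lt_of_mul_lt_mul_left ((h2.trans h3).trans_lt hm) (hθ 1).1.le
  linarith

/-- A bounded coordinatewise null sequence in `c₀₀` has small convex combinations. -/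
theorem exists_convexCombination_limNorm_le (hθ : ∀ n, θ n ∈ Ioo (0 : ℝ) 1)
    (hθ0 : Tendsto θ atTop (𝓝 0))
    (hA : ∀ n, ∀ 𝓔 ∈ A n, IsAllowable n 𝓔) (hA1 : ∀ 𝓔, IsAllowable 1 𝓔 → 𝓔 ∈ A 1)
    {u : ℕ → C00} {C : ℝ} (hu : ∀ k, limNorm θ A (u k) ≤ C)
    (hu0 : ∀ j, Tendsto (fun k => u k j) atTop (𝓝 0)) {ε : ℝ} (hε : 0 < ε) :
    ∃ (n : ℕ) (a : ℕ → ℝ), (∀ k, 0 ≤ a k) ∧ ∑ k ∈ Finset.range n, a k = 1 ∧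
      limNorm θ A (∑ k ∈ Finset.range n, a k • u k) ≤ ε := by
  have hAd : DisjointFams A := fun n 𝓔 h => (hA n 𝓔 h).disjoint
  have : CompactSpace (normingClosure θ A) :=
    isCompact_iff_compactSpace.1 (isCompact_normingClosure hθ hAd)
  let g : ℕ → C(normingClosure θ A, ℝ) := fun k =>
    ⟨fun f => pairing f (u k), (continuous_pairing (u k)).comp continuous_subtype_val⟩
  obtain ⟨n, a, ha, ha1, hle⟩ := exists_convexCombination_le g (C := C)
    (fun k f => pairing_nonneg (nonneg_of_mem_normingClosure hθ f.2) _)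
    (fun k f => (pairing_le_of_mem_normingClosure hθ hAd f.2 _).trans (hu k))
    (fun f => tendsto_pairing hθ hθ0 hA hA1 hu hu0 f.2) hε
  refine ⟨n, a, ha, ha1, limNorm_le_of_norming hθ fun f hf => ?_⟩
  refine le_trans ?_ (hle ⟨f, subset_closure hf⟩)
  refine (Finset.le_sum_of_subadditive (pairing f) ?_ (pairing_add_le (hf.nonneg hθ)) _ _).trans
    (Finset.sum_le_sum fun k _ => ?_)
  · simp [pairing]
  · rw [pairing_smul, abs_of_nonneg (ha k)]
    exact le_rfl

end

/-! ### Absence of ℓ₁ in the limit norms. -/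

/-! ### Lower `ℓ₁` estimates and the completions -/

/-- The lower `ℓ₁` estimate with constant `δ` for a sequence of vectors. -/
def LowerEll1 {E : Type*} [AddCommGroup E] [Module ℝ E] (N : E → ℝ) (δ : ℝ) (u : ℕ → E) : Prop :=
  ∀ (m : ℕ) (a : ℕ → ℝ), δ * ∑ k ∈ Finset.range m, |a k| ≤ N (∑ k ∈ Finset.range m, a k • u k)

section

variable {E : Type*} [AddCommGroup E] [Module ℝ E] {N : E → ℝ} {δ : ℝ} {u : ℕ → E}

theorem LowerEll1.comp (h : LowerEll1 N δ u) {φ : ℕ → ℕ} (hφ : Function.Injective φ) :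
    LowerEll1 N δ (u ∘ φ) := by
  intro m a
  obtain ⟨M, hM⟩ := ((Finset.range m).image φ).exists_nat_subset_range
  have hz : ∀ i, i ∉ (Finset.range m).image φ →
      Function.extend φ (fun k => if k < m then a k else 0) 0 i = 0 := by
    intro i hi
    by_cases hx : ∃ k, φ k = i
    · obtain ⟨k, rfl⟩ := hx
      rw [hφ.extend_apply, if_neg]
      exact fun hk => hi (Finset.mem_image_of_mem _ (Finset.mem_range.2 hk))
    · rw [Function.extend_apply' _ _ _ hx, Pi.zero_apply]
  have h1 := h M (Function.extend φ (fun k => if k < m then a k else 0) 0)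
  rw [← Finset.sum_subset hM (fun i _ hi => by rw [hz i hi, abs_zero]),
    ← Finset.sum_subset hM (fun i _ hi => by rw [hz i hi, zero_smul]),
    Finset.sum_image hφ.injOn, Finset.sum_image hφ.injOn] at h1
  convert h1 using 2
  · refine Finset.sum_congr rfl fun k hk => ?_
    rw [hφ.extend_apply, if_pos (Finset.mem_range.1 hk)]
  · refine Finset.sum_congr rfl fun k hk => ?_
    rw [hφ.extend_apply, if_pos (Finset.mem_range.1 hk), Function.comp_apply]

theorem sum_range_two_mul {M : Type*} [AddCommMonoid M] (F : ℕ → M) (n : ℕ) :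
    ∑ k ∈ Finset.range (2 * n), F k = ∑ k ∈ Finset.range n, (F (2 * k) + F (2 * k + 1)) := by
  induction n with
  | zero => simp
  | succ n ih =>
    rw [mul_add, mul_one, Finset.sum_range_succ, Finset.sum_range_succ, ih,
      Finset.sum_range_succ, add_assoc]

/-- Each coefficient occurs twice, with opposite signs, which doubles the constant. The strict gain
from δ to 2δ gives the contradiction in `not_lowerEll1_limNorm`. -/
theorem LowerEll1.sub (h : LowerEll1 N δ u) :
    LowerEll1 N (2 * δ) fun k => u (2 * k) - u (2 * k + 1) := by
  intro m a
  have h1 := h (2 * m) fun k => if Even k then a (k / 2) else -a (k / 2)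
  rw [sum_range_two_mul, sum_range_two_mul] at h1
  have h2 : ∀ k : ℕ, (2 * k + 1) / 2 = k := fun k => by lia
  simp only [even_two, Even.mul_right, if_true, Nat.not_even_bit1, if_false, abs_neg, h2,
    Nat.mul_div_cancel_left _ two_pos, ← two_mul, ← Finset.mul_sum] at h1
  simp only [smul_sub]
  simp only [neg_smul, ← sub_eq_add_neg] at h1
  linarith

end

section

variable (p : Seminorm ℝ C00)

/-- The canonical map from `c₀₀` to the completion. -/
def toCompl : C00 →ₗ[ℝ] Compl p where
  toFun x := ((show Normed p from x : Normed p) : UniformSpace.Completion (Normed p))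
  map_add' x y := UniformSpace.Completion.coe_add (α := Normed p) x y
  map_smul' c x := UniformSpace.Completion.coe_smul (X := Normed p) c x

theorem norm_toCompl (x : C00) : ‖toCompl p x‖ = p x :=
  UniformSpace.Completion.norm_coe (E := Normed p) x

theorem exists_toCompl_near (y : Compl p) {ε : ℝ} (hε : 0 < ε) :
    ∃ x, ‖y - toCompl p x‖ < ε := by
  obtain ⟨x, hx⟩ := (UniformSpace.Completion.denseRange_coe (α := Normed p)).exists_dist_lt y hε
  exact ⟨x, by rwa [dist_eq_norm] at hx⟩

end

theorem toSeminorm_apply {N : C00 → ℝ} (hN : Tame N) (x : C00) : hN.toSeminorm x = N x := rfl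

/-- A diagonal subsequence converges in every coordinate, by compactness of the product of
intervals; consecutive differences of it are coordinatewise null. -/
theorem exists_subseq_coordinates {u : ℕ → C00} {C : ℝ} (hu : ∀ k j, |u k j| ≤ C) :
    ∃ φ : ℕ → ℕ, StrictMono φ ∧
      ∀ j, Tendsto (fun k => (u (φ (2 * k)) - u (φ (2 * k + 1))) j) atTop (𝓝 0) := by
  obtain ⟨L, -, φ, hφ, hL⟩ := (isCompact_univ_pi fun _ : ℕ+ =>
    isCompact_Icc (a := -C) (b := C)).tendsto_subseq (x := fun k j => u k j)
    (fun k j _ => abs_le.1 (hu k j))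
  refine ⟨φ, hφ, fun j => ?_⟩
  have h1 : Tendsto (fun k => u (φ k) j) atTop (𝓝 (L j)) := (tendsto_pi_nhds.1 hL) j
  have h2 : StrictMono fun k : ℕ => 2 * k := fun a b h => by dsimp only; lia
  have h3 : StrictMono fun k : ℕ => 2 * k + 1 := fun a b h => by dsimp only; lia
  simpa using (h1.comp h2.tendsto_atTop).sub (h1.comp h3.tendsto_atTop)

theorem Ell1.norm_sum_single (m : ℕ) (a : ℕ → ℝ) :
    ‖∑ k ∈ Finset.range m, a k • (lp.single 1 k (1 : ℝ) : Ell1)‖ =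
      ∑ k ∈ Finset.range m, |a k| := by
  have h := lp.norm_sum_single (p := 1) (E := fun _ : ℕ => ℝ) (by norm_num) a (Finset.range m)
  simp only [ENNReal.toReal_one, Real.rpow_one, Real.norm_eq_abs] at h
  rw [← h]
  congr 1
  refine Finset.sum_congr rfl fun k _ => ?_
  rw [← lp.single_smul, smul_eq_mul, mul_one]

section

variable {θ : ℕ+ → ℝ} {A : ℕ+ → Set (Finset (Finset ℕ+))}

theorem supNorm_le_limNorm (hθ : ∀ n, θ n ∈ Ioo (0 : ℝ) 1) (hA : DisjointFams A) (x : C00) :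
    supNorm x ≤ limNorm θ A x := iterNorm_le_limNorm hθ hA 0 x

theorem not_lowerEll1_limNorm (hθ : ∀ n, θ n ∈ Ioo (0 : ℝ) 1) (hθ0 : Tendsto θ atTop (𝓝 0))
    (hA : ∀ n, ∀ 𝓔 ∈ A n, IsAllowable n 𝓔) (hA1 : ∀ 𝓔, IsAllowable 1 𝓔 → 𝓔 ∈ A 1)
    {u : ℕ → C00} {C δ : ℝ} (hu : ∀ k, limNorm θ A (u k) ≤ C) (hδ : 0 < δ) :
    ¬ LowerEll1 (limNorm θ A) δ u := by
  intro h
  have hAd : DisjointFams A := fun n 𝓔 h => (hA n 𝓔 h).disjoint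
  have hl := tame_limNorm hθ hAd
  obtain ⟨φ, hφ, hlim⟩ := exists_subseq_coordinates (u := u) (C := C) fun k j =>
    (abs_le_supNorm _ j).trans ((supNorm_le_limNorm hθ hAd _).trans (hu k))
  obtain ⟨n, a, ha, ha1, hle⟩ := exists_convexCombination_limNorm_le hθ hθ0 hA hA1
    (C := C + C) (fun k => by
      rw [sub_eq_add_neg, ← neg_one_smul ℝ]
      refine (hl.add _ _).trans (add_le_add (hu _) ?_)
      rw [hl.smul, abs_neg, abs_one, one_mul]
      exact hu _) hlim hδ
  have h1 := (h.comp hφ.injective).sub n a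
  simp only [Function.comp_apply] at h1
  rw [Finset.sum_congr rfl fun k _ => abs_of_nonneg (ha k), ha1] at h1
  linarith

/-- The image of the unit vector basis has lower constant 1/K. Approximating it from c₀₀ within
1/(2K) leaves 1/(2K), which `not_lowerEll1_limNorm` excludes. -/
theorem not_containsEll1_compl_limNorm (hθ : ∀ n, θ n ∈ Ioo (0 : ℝ) 1)
    (hθ0 : Tendsto θ atTop (𝓝 0)) (hAd : DisjointFams A)
    (hA : ∀ n, ∀ 𝓔 ∈ A n, IsAllowable n 𝓔) (hA1 : ∀ 𝓔, IsAllowable 1 𝓔 → 𝓔 ∈ A 1) :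
    ¬ ContainsEll1 (Compl (tame_limNorm hθ hAd).toSeminorm) := by
  set p := (tame_limNorm hθ hAd).toSeminorm with hp
  rintro ⟨Y, ⟨e⟩⟩
  let y : ℕ → Y := fun k => e.symm (lp.single 1 k (1 : ℝ))
  set K : ℝ := ‖(e : Y →L[ℝ] Ell1)‖ + 1 with hK
  have hK0 : 0 < K := by positivity
  have hlow : ∀ (m : ℕ) (a : ℕ → ℝ), ∑ k ∈ Finset.range m, |a k| ≤
      K * ‖∑ k ∈ Finset.range m, a k • (y k : Compl p)‖ := by
    intro m a
    have h1 : e (∑ k ∈ Finset.range m, a k • y k) =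
        ∑ k ∈ Finset.range m, a k • (lp.single 1 k (1 : ℝ) : Ell1) := by
      simp [map_sum, map_smul, y]
    have h2 := (e : Y →L[ℝ] Ell1).le_opNorm (∑ k ∈ Finset.range m, a k • y k)
    rw [ContinuousLinearEquiv.coe_coe, h1, Ell1.norm_sum_single] at h2
    have h3 : ‖∑ k ∈ Finset.range m, a k • y k‖ =
        ‖∑ k ∈ Finset.range m, a k • (y k : Compl p)‖ := by
      have h4 : ((∑ k ∈ Finset.range m, a k • y k : Y) : Compl p) =
          ∑ k ∈ Finset.range m, a k • (y k : Compl p) := by simp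
      rw [← h4, Submodule.coe_norm]
    rw [← h3]
    refine h2.trans (mul_le_mul_of_nonneg_right ?_ (norm_nonneg _))
    linarith
  have hη : 0 < 1 / (2 * K) := by positivity
  choose u hu using fun k => exists_toCompl_near p (y k) hη
  refine not_lowerEll1_limNorm hθ hθ0 hA hA1 (u := u) (δ := 1 / (2 * K))
    (C := ‖(e.symm : Ell1 →L[ℝ] Y)‖ * 1 + 1 / (2 * K)) (fun k => ?_) hη fun m a => ?_
  · rw [← toSeminorm_apply (tame_limNorm hθ hAd), ← norm_toCompl]
    have h1 : ‖(y k : Compl p)‖ ≤ ‖(e.symm : Ell1 →L[ℝ] Y)‖ * 1 := by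
      have := (e.symm : Ell1 →L[ℝ] Y).le_opNorm (lp.single 1 k (1 : ℝ))
      rw [lp.norm_single (by norm_num), norm_one] at this
      exact this
    have h2 := norm_le_norm_add_norm_sub (y k : Compl p) (toCompl p (u k))
    have h3 := hu k
    linarith
  · rw [← toSeminorm_apply (tame_limNorm hθ hAd), ← norm_toCompl, map_sum]
    simp only [map_smul]
    have h1 : ‖∑ k ∈ Finset.range m, a k • (y k : Compl p) -
        ∑ k ∈ Finset.range m, a k • toCompl p (u k)‖ ≤
        (∑ k ∈ Finset.range m, |a k|) * (1 / (2 * K)) := by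
      rw [← Finset.sum_sub_distrib, Finset.sum_mul]
      refine norm_sum_le_of_le _ fun k _ => ?_
      rw [← smul_sub, norm_smul, Real.norm_eq_abs]
      exact mul_le_mul_of_nonneg_left (hu k).le (abs_nonneg _)
    have h2 := hlow m a
    have h3 := norm_le_norm_add_norm_sub' (∑ k ∈ Finset.range m, a k • (y k : Compl p))
      (∑ k ∈ Finset.range m, a k • toCompl p (u k))
    have h4 : K * (1 / (2 * K)) = 1 / 2 := by field_simp
    have h5 : 1 / (2 * K) * ∑ k ∈ Finset.range m, |a k| ≤
        1 / (2 * K) * (K * ‖∑ k ∈ Finset.range m, a k • (y k : Compl p)‖) :=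
      mul_le_mul_of_nonneg_left h2 hη.le
    have h6 : (∑ k ∈ Finset.range m, |a k|) / K ≤
        ‖∑ k ∈ Finset.range m, a k • (y k : Compl p)‖ := by
      rwa [div_le_iff₀' hK0]
    have h7 : 1 / (2 * K) * ∑ k ∈ Finset.range m, |a k| =
      (∑ k ∈ Finset.range m, |a k|) / K - (∑ k ∈ Finset.range m, |a k|) * (1 / (2 * K)) := by
      field_simp; norm_num
    linarith

/-! ### The sum norms; non-isomorphism with ℓ₁. -/

/-- The norm of the spaces `V'` and `W'`. -/
def sumNorm (θ : ℕ+ → ℝ) (A : ℕ+ → Set (Finset (Finset ℕ+))) (α : ℕ+ → ℝ) : C00 → ℝ :=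
  weightedSum α fun n : ℕ+ => iterNorm θ A n

variable {α : ℕ+ → ℝ}

theorem summable_sumNorm (hθ : ∀ n, θ n ∈ Ioo (0 : ℝ) 1) (hAd : DisjointFams A)
    (hα : ∀ n, α n ∈ Ioo (0 : ℝ) 1) (hsum : HasSum α 1) (x : C00) :
    Summable fun n : ℕ+ => α n * iterNorm θ A n x :=
  summable_weighted (N := fun n : ℕ+ => iterNorm θ A n) hα hsum
    (fun n => tame_iterNorm hθ hAd n) x

theorem tame_sumNorm (hθ : ∀ n, θ n ∈ Ioo (0 : ℝ) 1) (hAd : DisjointFams A)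
    (hα : ∀ n, α n ∈ Ioo (0 : ℝ) 1) (hsum : HasSum α 1) : Tame (sumNorm θ A α) :=
  tame_weightedSum (N := fun n : ℕ+ => iterNorm θ A n) hα hsum fun n => tame_iterNorm hθ hAd n

theorem sumNorm_le_limNorm (hθ : ∀ n, θ n ∈ Ioo (0 : ℝ) 1) (hAd : DisjointFams A)
    (hα : ∀ n, α n ∈ Ioo (0 : ℝ) 1) (hsum : HasSum α 1) (x : C00) :
    sumNorm θ A α x ≤ limNorm θ A x := by
  have h : sumNorm θ A α x ≤ ∑' n, α n * limNorm θ A x :=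
    (summable_sumNorm hθ hAd hα hsum x).tsum_le_tsum
      (fun n => mul_le_mul_of_nonneg_left (iterNorm_le_limNorm hθ hAd n x) (hα n).1.le)
      (hsum.summable.mul_right _)
  rwa [tsum_mul_right, hsum.tsum_eq, one_mul] at h

theorem iterNorm_mono (hθ : ∀ n, θ n ∈ Ioo (0 : ℝ) 1) (hAd : DisjointFams A) (x : C00) :
    Monotone fun m => iterNorm θ A m x :=
  monotone_nat_of_le_succ fun m => iterNorm_le_succ hθ hAd m x

theorem supNorm_le_sumNorm (hθ : ∀ n, θ n ∈ Ioo (0 : ℝ) 1) (hAd : DisjointFams A)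
    (hα : ∀ n, α n ∈ Ioo (0 : ℝ) 1) (hsum : HasSum α 1) (x : C00) :
    supNorm x ≤ sumNorm θ A α x := by
  have h : ∑' n, α n * supNorm x ≤ sumNorm θ A α x :=
    (hsum.summable.mul_right _).tsum_le_tsum (fun n => mul_le_mul_of_nonneg_left
      (iterNorm_mono hθ hAd x (Nat.zero_le n)) (hα n).1.le) (summable_sumNorm hθ hAd hα hsum x)
  rwa [tsum_mul_right, hsum.tsum_eq, one_mul] at h

/-- The absolute value of the `n`-th coordinate, as a seminorm on `ℓ₁`. -/
def Ell1.coordinate (n : ℕ) : Seminorm ℝ Ell1 :=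
  Seminorm.of (fun a => |a n|) (fun _ _ => abs_add_le _ _) fun _ _ => abs_mul _ _

/-- Differences `d` of unit vectors are chosen coordinatewise null both in c₀₀ and, after the
isomorphism, in ℓ₁. The gliding hump in ℓ₁ gives them a lower ℓ₁ estimate, while the limit norm,
which dominates the sum norm, has small convex combinations of them. -/
theorem not_isomorphicToEll1_compl_sumNorm (hθ : ∀ n, θ n ∈ Ioo (0 : ℝ) 1)
    (hθ0 : Tendsto θ atTop (𝓝 0)) (hAd : DisjointFams A)
    (hA : ∀ n, ∀ 𝓔 ∈ A n, IsAllowable n 𝓔) (hA1 : ∀ 𝓔, IsAllowable 1 𝓔 → 𝓔 ∈ A 1)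
    (hα : ∀ n, α n ∈ Ioo (0 : ℝ) 1) (hsum : HasSum α 1) :
    ¬ IsomorphicToEll1 (Compl (tame_sumNorm hθ hAd hα hsum).toSeminorm) := by
  set p := (tame_sumNorm hθ hAd hα hsum).toSeminorm with hp
  rintro ⟨T⟩
  have hl := tame_limNorm hθ hAd
  let S : C00 →ₗ[ℝ] Ell1 := T.toLinearEquiv.toLinearMap ∘ₗ toCompl p
  set K : ℝ := ‖(T : Compl p →L[ℝ] Ell1)‖ + 1 with hK
  set K' : ℝ := ‖(T.symm : Ell1 →L[ℝ] Compl p)‖ + 1 with hK'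
  have hK0 : 0 < K := by positivity
  have hK0' : 0 < K' := by positivity
  have hS : ∀ x, ‖S x‖ ≤ K * p x := fun x => by
    rw [← norm_toCompl]
    exact ((T : Compl p →L[ℝ] Ell1).le_opNorm _).trans
      (mul_le_mul_of_nonneg_right (by linarith) (norm_nonneg _))
  have hS' : ∀ x, p x ≤ K' * ‖S x‖ := fun x => by
    rw [← norm_toCompl]
    have h1 := (T.symm : Ell1 →L[ℝ] Compl p).le_opNorm (S x)
    have h2 : (T.symm : Ell1 →L[ℝ] Compl p) (S x) = toCompl p x := T.symm_apply_apply _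
    rw [h2] at h1
    exact h1.trans (mul_le_mul_of_nonneg_right (by linarith) (norm_nonneg _))
  let e : ℕ → C00 := fun k => Finsupp.single (Nat.succPNat k) 1
  have he : ∀ k, limNorm θ A (e k) ≤ 1 := fun k => (hl.le_l1 _).trans (l1Norm_single _).le
  have hpl : ∀ x, p x ≤ limNorm θ A x := sumNorm_le_limNorm hθ hAd hα hsum
  have hcoord : ∀ (a : Ell1) n, |a n| ≤ ‖a‖ := fun a n => by
    rw [Ell1.norm_eq]
    exact (Ell1.summable_abs a).le_tsum n fun _ _ => abs_nonneg _
  obtain ⟨L, -, φ, hφ, hL⟩ := (isCompact_univ_pi fun _ : ℕ =>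
    isCompact_Icc (a := -K) (b := K)).tendsto_subseq (x := fun k n => S (e k) n)
    (fun k n _ => abs_le.1 ((hcoord _ n).trans ((hS _).trans
      (mul_le_of_le_one_right hK0.le ((hpl _).trans (he k))))))
  have h2 : StrictMono fun k : ℕ => 2 * k := fun a b h => by dsimp only; lia
  have h3 : StrictMono fun k : ℕ => 2 * k + 1 := fun a b h => by dsimp only; lia
  let d : ℕ → C00 := fun k => e (φ (2 * k)) - e (φ (2 * k + 1))
  have hd : ∀ k, limNorm θ A (d k) ≤ 2 := fun k => by
    simp only [d]
    rw [sub_eq_add_neg, ← neg_one_smul ℝ]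
    refine (hl.add _ _).trans ?_
    rw [hl.smul, abs_neg, abs_one, one_mul]
    linarith [he (φ (2 * k)), he (φ (2 * k + 1))]
  have hd1 : ∀ k, 1 ≤ p (d k) := fun k => by
    refine le_trans ?_ (supNorm_le_sumNorm hθ hAd hα hsum (d k))
    refine le_trans (le_of_eq ?_) (abs_le_supNorm _ (Nat.succPNat (φ (2 * k))))
    have hne : (φ (2 * k + 1)).succPNat ≠ (φ (2 * k)).succPNat := fun h => by
      have := hφ.injective (Nat.succPNat_injective h)
      lia
    simp [d, e, hne]
  have hSd : ∀ n, Tendsto (fun k => Ell1.coordinate n (S (d k))) atTop (𝓝 0) := fun n => by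
    have h1 : Tendsto (fun k => S (e (φ k)) n) atTop (𝓝 (L n)) := (tendsto_pi_nhds.1 hL) n
    have h4 := ((h1.comp h2.tendsto_atTop).sub (h1.comp h3.tendsto_atTop)).abs
    simp only [sub_self, abs_zero] at h4
    refine h4.congr fun k => ?_
    simp only [d, map_sub]
    rfl
  have htsum : ∀ a : Ell1, ∑' n, Ell1.coordinate n a = ‖a‖ := fun a => (Ell1.norm_eq a).symm
  obtain ⟨ψ, hψ, hlow⟩ := exists_subseq_lower_l1 Ell1.coordinate (fun k => S (d k))
    (fun a => Ell1.summable_abs a) (c := 1 / K') (by positivity)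
    (fun k => by
      rw [htsum, div_le_iff₀' hK0']
      exact (hd1 k).trans (hS' _)) hSd
  have hdcoord : ∀ j, Tendsto (fun k => d (ψ k) j) atTop (𝓝 0) := fun j => by
    refine tendsto_const_nhds.congr' ?_
    filter_upwards [eventually_ge_atTop (j : ℕ)] with k hk
    have h5 : ∀ i, k ≤ i → e (φ i) j = 0 := fun i hi => by
      simp only [e, Finsupp.single_apply]
      rw [if_neg]
      intro h
      have h6 := congrArg PNat.val h
      simp only [Nat.succPNat_coe, Nat.succ_eq_add_one] at h6
      have h7 := hφ.id_le i
      simp only [id] at h7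
      change φ i + 1 = (j : ℕ) at h6
      lia
    have h8 := hψ.id_le k
    simp only [id] at h8
    simp only [d, Finsupp.sub_apply]
    rw [h5 _ (by lia), h5 _ (by lia), sub_zero]
  -- The bound is chosen so that `S` maps the combination to norm at most 1/(4K'), below the 1/(2K')
  -- required by `hlow`.
  obtain ⟨n, a, ha, ha1, hle⟩ := exists_convexCombination_limNorm_le hθ hθ0 hA hA1
    (fun k => hd (ψ k)) hdcoord (show 0 < 1 / K' / 4 / K by positivity)
  have h6 := hlow n a
  rw [htsum, Finset.sum_congr rfl fun k _ => abs_of_nonneg (ha k), ha1] at h6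
  have h7 : ∑ k ∈ Finset.range n, a k • S (d (ψ k)) =
      S (∑ k ∈ Finset.range n, a k • d (ψ k)) := by simp [map_sum]
  rw [h7] at h6
  have h8 := h6.trans ((hS _).trans (mul_le_mul_of_nonneg_left ((hpl _).trans hle) hK0.le))
  have h9 : K * (1 / K' / 4 / K) = 1 / K' / 4 := by field_simp
  have h10 : 0 < 1 / K' := by positivity
  linarith

end

/-! ### Block sequences -/

theorem exists_seq_of_step {β : Type*} (R : ℕ+ → β → ℕ+ → Prop)
    (h : ∀ N, ∃ b N', N < N' ∧ R N b N') :
    ∃ (N : ℕ → ℕ+) (b : ℕ → β), StrictMono N ∧ ∀ k, R (N k) (b k) (N (k + 1)) := by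
  choose b N' hN hR using h
  let S : ℕ → ℕ+ := fun k => Nat.rec 1 (fun _ N => N' N) k
  exact ⟨S, fun k => b (S k), strictMono_nat_of_lt_succ fun k => hN (S k), fun k => hR (S k)⟩

theorem lt_of_strictMono_pnat {N : ℕ → ℕ+} (hN : StrictMono N) (k : ℕ) : k < (N k : ℕ) := by
  induction k with
  | zero => exact (N 0).pos
  | succ k ih =>
    have h : (N k : ℕ) < N (k + 1) := hN (Nat.lt_succ_self k)
    lia

theorem half_pow_le {N : ℕ → ℕ+} (hN : StrictMono N) (k : ℕ) :
    (1 / 2 : ℝ) ^ (N k : ℕ) ≤ (1 / 2) ^ k :=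
  pow_le_pow_of_le_one (by norm_num) (by norm_num) (lt_of_strictMono_pnat hN k).le

/-- The `k`-th vector is supported in `(N k, N (k + 1)]`. -/
structure IsBlock (N : ℕ → ℕ+) (z : ℕ → C00) : Prop where
  strictMono : StrictMono N
  lt : ∀ k j, z k j ≠ 0 → N k < j
  le : ∀ k j, z k j ≠ 0 → j ≤ N (k + 1)

theorem IsBlock.lt_of_lt {N : ℕ → ℕ+} {z : ℕ → C00} (h : IsBlock N z) {k l : ℕ} (hkl : k < l)
    {i j : ℕ+} (hi : z k i ≠ 0) (hj : z l j ≠ 0) : i < j :=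
  (h.le k i hi).trans_lt ((h.strictMono.monotone hkl).trans_lt (h.lt l j hj))

theorem IsBlock.eq_of_ne_zero {N : ℕ → ℕ+} {z : ℕ → C00} (h : IsBlock N z) {k l : ℕ} {j : ℕ+}
    (hk : z k j ≠ 0) (hl : z l j ≠ 0) : k = l := by
  rcases lt_trichotomy k l with hkl | hkl | hkl
  · exact absurd (h.lt_of_lt hkl hk hl) (lt_irrefl _)
  · exact hkl
  · exact absurd (h.lt_of_lt hkl hl hk) (lt_irrefl _)

/-- The common counting device for block sums: a functional sees at most one block in full, and the
others contribute a geometric series. -/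
theorem sum_le_of_geometric {a : ℕ → ℝ} {D : ℝ} (hD : 0 ≤ D) (bad : ℕ → Prop)
    (hbad : ∀ k l, bad k → bad l → k = l) (h1 : ∀ k, a k ≤ D)
    (h2 : ∀ k, ¬ bad k → a k ≤ (1 / 2) ^ k) (n : ℕ) :
    ∑ k ∈ Finset.range n, a k ≤ D + 2 := by
  classical
  have h3 : ∀ k, a k ≤ (if bad k then D else 0) + (1 / 2) ^ k := fun k => by
    split_ifs with h
    · have : (0 : ℝ) ≤ (1 / 2) ^ k := by positivity
      linarith [h1 k]
    · linarith [h2 k h]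
  refine (Finset.sum_le_sum fun k _ => h3 k).trans ?_
  rw [Finset.sum_add_distrib]
  refine add_le_add ?_ (sum_geometric_two_le n)
  by_cases hex : ∃ k ∈ Finset.range n, bad k
  · obtain ⟨k, hk, hb⟩ := hex
    rw [Finset.sum_eq_single_of_mem k hk fun l _ hl =>
      if_neg fun hbl => hl (hbad l k hbl hb), if_pos hb]
  · rw [Finset.sum_eq_zero fun l hl => if_neg fun hb => hex ⟨l, hl, hb⟩]
    exact hD

/-- A subspace of `c₀₀` with vectors supported arbitrarily far out. -/
def Rich (Z : Submodule ℝ C00) : Prop := ∀ n : ℕ+, ∃ z ∈ Z, z ≠ 0 ∧ ∀ j ≤ n, z j = 0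

/-- The vectors of `Z` which vanish on `{1, …, n}`. -/
def tailSpace (Z : Submodule ℝ C00) (n : ℕ+) : Submodule ℝ C00 where
  carrier := {z | z ∈ Z ∧ ∀ j ≤ n, z j = 0}
  add_mem' ha hb := ⟨Z.add_mem ha.1 hb.1, fun j hj => by
    rw [Finsupp.add_apply, ha.2 j hj, hb.2 j hj, add_zero]⟩
  zero_mem' := ⟨Z.zero_mem, fun _ _ => rfl⟩
  smul_mem' c _ ha := ⟨Z.smul_mem c ha.1, fun j hj => by
    rw [Finsupp.smul_apply, ha.2 j hj, smul_zero]⟩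

theorem tailSpace_le (Z : Submodule ℝ C00) (n : ℕ+) : tailSpace Z n ≤ Z := fun _ h => h.1

theorem Rich.tailSpace {Z : Submodule ℝ C00} (h : Rich Z) (n : ℕ+) : Rich (tailSpace Z n) := by
  intro m
  obtain ⟨z, hz, hne, h0⟩ := h (max m n)
  exact ⟨z, ⟨hz, fun j hj => h0 j (hj.trans (le_max_right _ _))⟩, hne,
    fun j hj => h0 j (hj.trans (le_max_left _ _))⟩

theorem exists_support_le (z : C00) (n : ℕ+) : ∃ M, n < M ∧ ∀ j, z j ≠ 0 → j ≤ M := by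
  obtain ⟨M, hM⟩ := z.support.exists_le
  refine ⟨max M (n + 1), lt_of_lt_of_le (PNat.lt_add_right n 1) (le_max_right _ _), fun j hj => ?_⟩
  exact (hM j (Finsupp.mem_support_iff.2 hj)).trans (le_max_left _ _)

/-! ### Splitting of families -/

/-- Families `B n` of allowable sets, given for all `n ≥ 0`, which extend `A` and are compatible
with the passage from `S_{n+1}` to `S_n`. -/
structure Splits (A : ℕ+ → Set (Finset (Finset ℕ+))) (B : ℕ → Set (Finset (Finset ℕ+))) :
    Prop where
  eq : ∀ n : ℕ+, A n = B n
  allowable : ∀ n, ∀ 𝓔 ∈ B n, IsAllowable n 𝓔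
  one : ∀ 𝓔, IsAllowable 1 𝓔 → 𝓔 ∈ B 1
  sub : ∀ n, ∀ 𝓔 ∈ B (n + 1), ∀ 𝓕 ⊆ 𝓔, MinsInSchreier n 𝓕 → 𝓕 ∈ B n

/-- All sums `∑ N (E_i x)` over families in `B n`, `n ≤ q`, are at most `b`. -/
def FamBound (B : ℕ → Set (Finset (Finset ℕ+))) (N : C00 → ℝ) (q : ℕ) (x : C00) (b : ℝ) : Prop :=
  ∀ n ≤ q, ∀ 𝓔 ∈ B n, ∑ E ∈ 𝓔, N (restrict E x) ≤ b

section

variable {θ : ℕ+ → ℝ} {A : ℕ+ → Set (Finset (Finset ℕ+))} {B : ℕ → Set (Finset (Finset ℕ+))}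
  {N : C00 → ℝ}

theorem sum_restrict_smul (hN : Tame N) (𝓔 : Finset (Finset ℕ+)) (c : ℝ) (x : C00) :
    ∑ E ∈ 𝓔, N (restrict E (c • x)) = |c| * ∑ E ∈ 𝓔, N (restrict E x) := by
  rw [Finset.mul_sum]
  refine Finset.sum_congr rfl fun E _ => ?_
  rw [restrict, Finsupp.filter_smul, hN.smul]
  rfl

theorem FamBound.smul (hN : Tame N) {q : ℕ} {x : C00} {b : ℝ} (h : FamBound B N q x b) (c : ℝ) :
    FamBound B N q (c • x) (|c| * b) := fun n hn 𝓔 h𝓔 => by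
  rw [sum_restrict_smul hN]
  exact mul_le_mul_of_nonneg_left (h n hn 𝓔 h𝓔) (abs_nonneg c)

theorem FamBound.mono {q : ℕ} {x : C00} {b b' : ℝ} (h : FamBound B N q x b) (hb : b ≤ b') :
    FamBound B N q x b' := fun n hn 𝓔 h𝓔 => (h n hn 𝓔 h𝓔).trans hb

theorem famBound_zero (hs : Splits A B) (hN : Tame N)
    (hNr : ∀ E x, N (restrict E x) ≤ N x) (x : C00) : FamBound B N 0 x (N x) := by
  intro n hn 𝓔 h𝓔
  obtain rfl : n = 0 := by lia
  have hall := hs.allowable 0 𝓔 h𝓔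
  have h1 : 𝓔.image minOf ∈ schreier 0 := (minsInSchreier_iff hall.nonempty).1 hall.mins
  have hcard : 𝓔.card ≤ 1 := by
    rw [← Finset.card_image_of_injOn hall.injOn_minOf]
    rcases h1 with h1 | ⟨j, h1⟩ <;> simp [h1]
  refine (Finset.sum_le_card_nsmul 𝓔 _ (N x) fun E _ => hNr E x).trans ?_
  rw [nsmul_eq_mul]
  exact mul_le_of_le_one_left (hN.nonneg x) (by exact_mod_cast hcard)

/-- The members of a family in `B (q + 1)` are distributed over at most `a` families in `B q`. -/
theorem Splits.sum_le (hs : Splits A B) (hN : Tame N) {q : ℕ} {x : C00} {b : ℝ}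
    (hb : 0 ≤ b) (h : FamBound B N q x b) {𝓔 : Finset (Finset ℕ+)} (h𝓔 : 𝓔 ∈ B (q + 1))
    {E : Finset ℕ+} (hE : E ∈ 𝓔) {a : ℕ+} (ha : a ∈ E) :
    ∑ E ∈ 𝓔, N (restrict E x) ≤ (a : ℕ) * b := by
  classical
  have hall := hs.allowable _ 𝓔 h𝓔
  obtain ⟨k, G, hG, hk, -, hF⟩ := (minsInSchreier_iff hall.nonempty).1 hall.mins
  have hpart : ∀ i, ∑ E ∈ 𝓔.filter (fun E => minOf E ∈ G i), N (restrict E x) ≤ b := by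
    intro i
    refine h q le_rfl _ (hs.sub q 𝓔 h𝓔 _ (Finset.filter_subset _ _) ?_)
    rw [minsInSchreier_iff fun E hE => hall.nonempty E (Finset.mem_filter.1 hE).1]
    convert hG i
    ext j
    simp only [Finset.mem_image, Finset.mem_filter]
    constructor
    · rintro ⟨E, ⟨-, hE⟩, rfl⟩
      exact hE
    · intro hj
      have h1 : j ∈ 𝓔.image minOf := hF ▸ Finset.mem_biUnion.2 ⟨i, Finset.mem_univ _, hj⟩
      obtain ⟨E, hE, rfl⟩ := Finset.mem_image.1 h1
      exact ⟨E, ⟨hE, hj⟩, rfl⟩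
  have hmem : ∀ E ∈ 𝓔, ∃ i, minOf E ∈ G i := fun E hE => by
    have h1 : minOf E ∈ 𝓔.image minOf := Finset.mem_image_of_mem _ hE
    rw [hF] at h1
    obtain ⟨i, -, hi⟩ := Finset.mem_biUnion.1 h1
    exact ⟨i, hi⟩
  -- The minimum of E lies in some piece `G i`, whose elements are at least k, and it is at most a.
  -- So any point of any member bounds the number of pieces.
  have hka : (k : ℕ) ≤ a := by
    obtain ⟨i, hi⟩ := hmem E hE
    exact (hk i _ hi).trans (minOf_le ha)
  calc ∑ E ∈ 𝓔, N (restrict E x)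
      ≤ ∑ E ∈ 𝓔, ∑ i, if minOf E ∈ G i then N (restrict E x) else 0 := by
        refine Finset.sum_le_sum fun E hE => ?_
        obtain ⟨i, hi⟩ := hmem E hE
        refine le_trans (by rw [if_pos hi]) (Finset.single_le_sum
          (f := fun i => if minOf E ∈ G i then N (restrict E x) else 0)
          (fun j _ => ?_) (Finset.mem_univ i))
        split_ifs
        · exact hN.nonneg _
        · exact le_rfl
    _ = ∑ i, ∑ E ∈ 𝓔.filter (fun E => minOf E ∈ G i), N (restrict E x) := by
        rw [Finset.sum_comm]
        exact Finset.sum_congr rfl fun i _ => (Finset.sum_filter _ _).symm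
    _ ≤ ∑ _i : Fin (k : ℕ), b := Finset.sum_le_sum fun i _ => hpart i
    _ = (k : ℕ) * b := by simp
    _ ≤ (a : ℕ) * b := mul_le_mul_of_nonneg_right (by exact_mod_cast hka) hb

/-! ### Sequences with bounded partial sums for the iterated norms. -/

/-- In `Z` there are vectors of norm `1` on which the families in `B n`, `n ≤ q`, are small. -/
def SmallVectors (B : ℕ → Set (Finset (Finset ℕ+))) (N p : C00 → ℝ) (q : ℕ)
    (Z : Submodule ℝ C00) : Prop :=
  ∀ ε > 0, ∃ z ∈ Z, p z = 1 ∧ FamBound B N q z ε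

/-- Every rich subspace contains a block sequence which is bounded below, but whose partial sums
are bounded. -/
def HasC0Sequences (p : C00 → ℝ) : Prop :=
  ∀ Z, Rich Z → ∃ (C : ℝ) (M : ℕ → ℕ+) (z : ℕ → C00), IsBlock M z ∧ (∀ k, z k ∈ Z) ∧
    (∀ k, 1 ≤ p (z k)) ∧ ∀ n, p (∑ k ∈ Finset.range n, z k) ≤ C

theorem sum_restrict_sum_le (hN : Tame N) (𝓔 : Finset (Finset ℕ+)) (z : ℕ → C00) (n : ℕ) :
    ∑ E ∈ 𝓔, N (restrict E (∑ k ∈ Finset.range n, z k)) ≤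
      ∑ k ∈ Finset.range n, ∑ E ∈ 𝓔, N (restrict E (z k)) := by
  rw [Finset.sum_comm]
  refine Finset.sum_le_sum fun E _ => ?_
  rw [restrict_sum]
  exact hN.sum_le _ _

theorem le_of_not_smallVectors (hN : Tame N) {p : C00 → ℝ} (hp : Tame p) {q : ℕ}
    {Z : Submodule ℝ C00} (h : ¬ SmallVectors B N p q Z) :
    ∃ K : ℝ, 0 < K ∧ ∀ z ∈ Z, ∀ b, 0 ≤ b → FamBound B N q z b → p z ≤ K * b := by
  unfold SmallVectors at h
  push Not at h
  obtain ⟨ε, hε, h⟩ := h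
  refine ⟨1 / ε, by positivity, fun z hz b hb hzb => ?_⟩
  by_contra! hlt
  have hpz : 0 < p z := lt_of_le_of_lt (by positivity) hlt
  refine h ((p z)⁻¹ • z) (Z.smul_mem _ hz) ?_ ((hzb.smul hN (p z)⁻¹).mono ?_)
  · rw [hp.smul, abs_of_pos (inv_pos.2 hpz), inv_mul_cancel₀ hpz.ne']
  · rw [abs_of_pos (inv_pos.2 hpz), ← div_eq_inv_mul, div_le_iff₀ hpz]
    rw [one_div, ← div_eq_inv_mul, div_lt_iff₀ hε] at hlt
    linarith

/-- Failure at level q + 1 means that on `Z` the families up to q + 1 control the whole norm.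
Smallness at level q gives blocks on which a family of `B (q + 1)` is negligible once it has met an
earlier block, so only the first block it meets counts. -/
theorem exists_c0Sequence_of_not_smallVectors (hθ : ∀ n, θ n ∈ Ioo (0 : ℝ) 1)
    (hAd : DisjointFams A) (hs : Splits A B) (hN : Tame N) {q : ℕ}
    {Z : Submodule ℝ C00} (hZ : Rich Z)
    (hsmall : ∀ Z' ≤ Z, Rich Z' → SmallVectors B N (step θ A N) q Z')
    (hnot : ¬ SmallVectors B N (step θ A N) (q + 1) Z) :
    ∃ (C : ℝ) (M : ℕ → ℕ+) (z : ℕ → C00), IsBlock M z ∧ (∀ k, z k ∈ Z) ∧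
      (∀ k, 1 ≤ step θ A N (z k)) ∧ ∀ n, step θ A N (∑ k ∈ Finset.range n, z k) ≤ C := by
  have hp : Tame (step θ A N) := hN.step hθ hAd
  obtain ⟨K, hK, hKle⟩ := le_of_not_smallVectors hN hp hnot
  obtain ⟨M, z, hM, hz⟩ := exists_seq_of_step (β := C00)
    (fun n z n' => z ∈ Z ∧ step θ A N z = 1 ∧ (∀ j, z j ≠ 0 → n < j) ∧
      (∀ j, z j ≠ 0 → j ≤ n') ∧ FamBound B N q z ((1 / 2) ^ (n : ℕ) / (n : ℕ))) (by
    intro n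
    -- The division by n absorbs the factor a in `Splits.sum_le`: a family that meets an earlier
    -- block has a point a ≤ n there.
    obtain ⟨z, hz, hz1, hzb⟩ := hsmall (tailSpace Z n) (tailSpace_le Z n) (hZ.tailSpace n)
      ((1 / 2) ^ (n : ℕ) / (n : ℕ)) (div_pos (by positivity) (by exact_mod_cast n.pos))
    obtain ⟨n', hn', hzn'⟩ := exists_support_le z n
    refine ⟨z, n', hn', hz.1, hz1, fun j hj => ?_, hzn', hzb⟩
    by_contra hle
    exact hj (hz.2 j (not_lt.1 hle)))
  have hblock : IsBlock M z := ⟨hM, fun k => (hz k).2.2.1, fun k => (hz k).2.2.2.1⟩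
  -- `q.succPNat` is q + 1. A family of that level has sum at most 1/θ on a vector of norm 1; this
  -- is the cost of the first block met.
  set D : ℝ := 1 / θ q.succPNat with hD
  have hD0 : 0 < D := one_div_pos.2 (hθ _).1
  refine ⟨K * (D + 2), M, z, hblock, fun k => (hz k).1, fun k => (hz k).2.1.ge, fun n => ?_⟩
  have hMpos : ∀ k, (0 : ℝ) < (M k : ℕ) := fun k => by exact_mod_cast (M k).pos
  have hε : ∀ k, (1 / 2 : ℝ) ^ (M k : ℕ) / (M k : ℕ) ≤ (1 / 2) ^ k := fun k => by
    refine (div_le_self (by positivity) ?_).trans (half_pow_le hM k)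
    exact_mod_cast (M k).pos
  refine hKle _ (Z.sum_mem fun k _ => (hz k).1) _ (by positivity) ?_
  intro m hm 𝓔 h𝓔
  refine (sum_restrict_sum_le hN 𝓔 z n).trans ?_
  rcases Nat.lt_or_ge q m with hqm | hmq
  · obtain rfl : m = q + 1 := by lia
    let hit : ℕ → Prop := fun k => ∃ E ∈ 𝓔, ∃ a ∈ E, z k a ≠ 0
    refine sum_le_of_geometric hD0.le (fun k => hit k ∧ ∀ l < k, ¬ hit l) ?_ ?_ ?_ n
    · rintro k l ⟨hk, hk'⟩ ⟨hl, hl'⟩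
      rcases lt_trichotomy k l with h | h | h
      · exact absurd hk (hl' k h)
      · exact h
      · exact absurd hl (hk' l h)
    · intro k
      have h1 := le_step hθ hAd hN.le_l1 (z k) (n := q.succPNat) (𝓔 := 𝓔)
        (by rw [hs.eq]; exact h𝓔)
      rw [(hz k).2.1] at h1
      rw [hD, le_div_iff₀' (hθ _).1]
      exact h1
    · intro k hk
      by_cases hh : hit k
      · have h1 : ∃ l < k, hit l := by
          by_contra! hno
          exact hk ⟨hh, hno⟩
        obtain ⟨l, hlk, E, hE, a, ha, hza⟩ := h1
        refine (hs.sum_le hN (by positivity) (hz k).2.2.2.2 h𝓔 hE ha).trans ?_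
        have h2 : ((a : ℕ) : ℝ) ≤ (M k : ℕ) := by
          exact_mod_cast (hblock.le l a hza).trans (hM.monotone hlk)
        refine (mul_le_mul_of_nonneg_right h2 (by positivity)).trans ?_
        rw [mul_div_cancel₀ _ (hMpos k).ne']
        exact half_pow_le hM k
      · have h0 : ∑ E ∈ 𝓔, N (restrict E (z k)) = 0 := Finset.sum_eq_zero fun E hE => by
          rw [restrict_eq_zero, hN.zero]
          intro j hj
          by_contra hzj
          exact hh ⟨E, hE, j, hj, hzj⟩
        rw [h0]
        positivity
  · refine (Finset.sum_le_sum fun k _ => ((hz k).2.2.2.2 m hmq 𝓔 h𝓔).trans (hε k)).trans ?_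
    exact (sum_geometric_two_le n).trans (by linarith)

/-- Blocks are chosen so that families of level m ≤ M k are small on z k by hypothesis, and those of
level m ≥ M (k + 1) because θ m beats its ℓ₁ norm. Each level m falls strictly between for at most
one k. -/
theorem exists_c0Sequence_of_smallVectors (hθ : ∀ n, θ n ∈ Ioo (0 : ℝ) 1)
    (hθ0 : Tendsto θ atTop (𝓝 0)) (hAd : DisjointFams A) (hs : Splits A B) (hN : Tame N)
    {Z : Submodule ℝ C00} (hZ : Rich Z)
    (hsmall : ∀ q, ∀ Z' ≤ Z, Rich Z' → SmallVectors B N (step θ A N) q Z') :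
    ∃ (C : ℝ) (M : ℕ → ℕ+) (z : ℕ → C00), IsBlock M z ∧ (∀ k, z k ∈ Z) ∧
      (∀ k, 1 ≤ step θ A N (z k)) ∧ ∀ n, step θ A N (∑ k ∈ Finset.range n, z k) ≤ C := by
  obtain ⟨M, z, hM, hz⟩ := exists_seq_of_step (β := C00)
    (fun n z n' => z ∈ Z ∧ step θ A N z = 1 ∧ (∀ j, z j ≠ 0 → n < j) ∧
      (∀ j, z j ≠ 0 → j ≤ n') ∧ FamBound B N n z ((1 / 2) ^ (n : ℕ)) ∧
      ∀ m ≥ n', θ m * l1Norm z ≤ (1 / 2) ^ (n : ℕ)) (by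
    intro n
    obtain ⟨z, hz, hz1, hzb⟩ := hsmall n (tailSpace Z n) (tailSpace_le Z n) (hZ.tailSpace n)
      ((1 / 2) ^ (n : ℕ)) (by positivity)
    obtain ⟨n', hn', hzn'⟩ := exists_support_le z n
    have hlim : Tendsto (fun m => θ m * l1Norm z) atTop (𝓝 0) := by
      simpa using hθ0.mul_const (l1Norm z)
    obtain ⟨m0, hm0⟩ := eventually_atTop.1 (hlim.eventually
      (gt_mem_nhds (show (0 : ℝ) < (1 / 2) ^ (n : ℕ) by positivity)))
    refine ⟨z, max n' m0, hn'.trans_le (le_max_left _ _), hz.1, hz1, fun j hj => ?_,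
      fun j hj => (hzn' j hj).trans (le_max_left _ _), hzb,
      fun m hm => (hm0 m ((le_max_right _ _).trans hm)).le⟩
    by_contra hle
    exact hj (hz.2 j (not_lt.1 hle)))
  have hblock : IsBlock M z := ⟨hM, fun k => (hz k).2.2.1, fun k => (hz k).2.2.2.1⟩
  refine ⟨1 + 2, M, z, hblock, fun k => (hz k).1, fun k => (hz k).2.1.ge, fun n => ?_⟩
  refine step_le (by norm_num) (ciSup_le fun j => ?_) fun m 𝓔 h𝓔 => ?_
  · rw [Finsupp.finsetSum_apply]
    refine (Finset.abs_sum_le_sum_abs _ _).trans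
      (sum_le_of_geometric zero_le_one (fun k => z k j ≠ 0) (fun k l => hblock.eq_of_ne_zero)
        (fun k => ?_) (fun k hk => ?_) n)
    · exact (abs_le_supNorm _ j).trans ((le_max_left _ _).trans (hz k).2.1.le)
    · rw [not_not.1 hk, abs_zero]
      positivity
  · refine (mul_le_mul_of_nonneg_left (sum_restrict_sum_le hN 𝓔 z n) (hθ m).1.le).trans ?_
    rw [Finset.mul_sum]
    refine sum_le_of_geometric zero_le_one (fun k => M k < m ∧ m < M (k + 1)) ?_ ?_ ?_ n
    · rintro k l ⟨hk, hk'⟩ ⟨hl, hl'⟩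
      rcases lt_trichotomy k l with h | h | h
      · exact absurd (hk'.trans_le ((hM.monotone h).trans hl.le)) (lt_irrefl _)
      · exact h
      · exact absurd (hl'.trans_le ((hM.monotone h).trans hk.le)) (lt_irrefl _)
    · exact fun k => (le_step hθ hAd hN.le_l1 (z k) h𝓔).trans (hz k).2.1.le
    · intro k hk
      refine le_trans ?_ (half_pow_le hM k)
      by_cases hmk : m ≤ M k
      · have h1 := (hz k).2.2.2.2.1 m hmk 𝓔 (by rw [← hs.eq]; exact h𝓔)
        refine (mul_le_of_le_one_left (Finset.sum_nonneg fun E _ => hN.nonneg _)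
          (hθ m).2.le).trans h1
      · have h1 : M (k + 1) ≤ m := by
          by_contra hlt
          exact hk ⟨not_le.1 hmk, not_le.1 hlt⟩
        refine le_trans ?_ ((hz k).2.2.2.2.2 m h1)
        exact mul_le_mul_of_nonneg_left ((Finset.sum_le_sum fun E _ => hN.le_l1 _).trans
          (sum_l1Norm_restrict_le 𝓔 (hAd m 𝓔 h𝓔) _)) (hθ m).1.le

/-- Dichotomy: either small vectors exist at every level in all rich subspaces, or there is a least
level of failure. It is not 0, since an S_0-family has at most one member and is therefore
controlled by `N`. -/
theorem hasC0Sequences_step (hθ : ∀ n, θ n ∈ Ioo (0 : ℝ) 1)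
    (hθ0 : Tendsto θ atTop (𝓝 0)) (hAd : DisjointFams A) (hs : Splits A B) (hN : Tame N)
    (hNr : ∀ E x, N (restrict E x) ≤ N x)
    (h : ∀ Z, Rich Z → ∀ ε > 0, ∃ z ∈ Z, step θ A N z = 1 ∧ N z ≤ ε) :
    HasC0Sequences (step θ A N) := by
  classical
  intro Z hZ
  by_cases hall : ∀ q, ∀ Z' ≤ Z, Rich Z' → SmallVectors B N (step θ A N) q Z'
  · exact exists_c0Sequence_of_smallVectors hθ hθ0 hAd hs hN hZ hall
  · push Not at hall
    obtain ⟨Z', hZ', hrich, hnot⟩ := Nat.find_spec hall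
    have hmin := fun {m} => Nat.find_min hall (m := m)
    cases hq : Nat.find hall with
    | zero =>
      rw [hq] at hnot
      refine absurd (fun ε hε => ?_) hnot
      obtain ⟨z, hz, hz1, hzε⟩ := h Z' hrich ε hε
      exact ⟨z, hz, hz1, (famBound_zero hs hN hNr z).mono hzε⟩
    | succ q =>
      rw [hq] at hnot
      have hq' := hmin (m := q) (by lia)
      push Not at hq'
      obtain ⟨C, M, z, hb, hz, h1, h2⟩ := exists_c0Sequence_of_not_smallVectors hθ hAd hs hN hrich
        (fun Z'' hZ'' hr => hq' Z'' (hZ''.trans hZ') hr) hnot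
      exact ⟨C, M, z, hb, fun k => hZ' (hz k), h1, h2⟩

/-- A sum of n blocks beginning with the n-th has `N` at most 2C, as a difference of partial sums.
Its n supports lie beyond n and form an S_1-allowable family, so the next norm is at least θ_1 n;
normalizing gives the vector. -/
theorem HasC0Sequences.exists_small (hθ : ∀ n, θ n ∈ Ioo (0 : ℝ) 1) (hAd : DisjointFams A)
    (hs : Splits A B) (hN : Tame N) (h : HasC0Sequences N) {Z : Submodule ℝ C00} (hZ : Rich Z)
    {ε : ℝ} (hε : 0 < ε) : ∃ z ∈ Z, step θ A N z = 1 ∧ N z ≤ ε := by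
  classical
  have hp : Tame (step θ A N) := hN.step hθ hAd
  obtain ⟨C, M, z, hb, hz, h1, h2⟩ := h Z hZ
  obtain ⟨n, hn⟩ := exists_nat_gt (2 * C / (θ 1 * ε))
  have hC : 0 ≤ C := (hN.nonneg _).trans (h2 0)
  have hn0 : 0 < (n : ℝ) := lt_of_le_of_lt (div_nonneg (by linarith)
    (mul_nonneg (hθ 1).1.le hε.le)) hn
  set x := ∑ k ∈ Finset.Ico n (2 * n), z k with hx
  have hNx : N x ≤ 2 * C := by
    have h3 : x = ∑ k ∈ Finset.range (2 * n), z k + (-1 : ℝ) • ∑ k ∈ Finset.range n, z k := by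
      rw [hx, Finset.sum_Ico_eq_sub _ (by lia), neg_one_smul, sub_eq_add_neg]
    rw [h3]
    refine (hN.add _ _).trans ?_
    rw [hN.smul, abs_neg, abs_one, one_mul]
    linarith [h2 (2 * n), h2 n]
  have hne : ∀ k, (z k).support.Nonempty := fun k => by
    rw [Finsupp.support_nonempty_iff]
    intro h0
    have := h1 k
    rw [h0, hN.zero] at this
    linarith
  have hdisj : ∀ k l, k ≠ l → Disjoint (z k).support (z l).support := fun k l hkl =>
    Finset.disjoint_left.2 fun j hj hj' =>
      hkl (hb.eq_of_ne_zero (Finsupp.mem_support_iff.1 hj) (Finsupp.mem_support_iff.1 hj'))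
  have hinj : Function.Injective fun k => (z k).support := fun k l hkl => by
    by_contra hne'
    obtain ⟨j, hj⟩ := hne k
    exact Finset.disjoint_left.1 (hdisj k l hne') hj (by simpa [← hkl] using hj)
  set 𝓔 := (Finset.Ico n (2 * n)).image fun k => (z k).support with h𝓔
  have hall : IsAllowable 1 𝓔 := by
    refine isAllowable_one ?_ ?_ ?_
    · simp only [h𝓔, Finset.mem_image]
      rintro _ ⟨k, -, rfl⟩
      exact hne k
    · simp only [h𝓔, Finset.mem_image]
      rintro _ ⟨k, -, rfl⟩ _ ⟨l, -, rfl⟩ hkl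
      exact hdisj k l fun h => hkl (by rw [h])
    · intro E hE a ha
      obtain ⟨k, hk, rfl⟩ := Finset.mem_image.1 hE
      have h3 : 𝓔.card ≤ n := by
        refine Finset.card_image_le.trans ?_
        rw [Nat.card_Ico]
        lia
      have h4 : M k < a := hb.lt k a (Finsupp.mem_support_iff.1 ha)
      have h5 := lt_of_strictMono_pnat hb.strictMono k
      have h6 := (Finset.mem_Ico.1 hk).1
      have h7 : (M k : ℕ) < a := h4
      lia
  have hpx : θ 1 * n ≤ step θ A N x := by
    have h3 := le_step hθ hAd hN.le_l1 x (n := 1) (𝓔 := 𝓔)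
      (by rw [hs.eq]; exact hs.one 𝓔 hall)
    refine le_trans (mul_le_mul_of_nonneg_left ?_ (hθ 1).1.le) h3
    rw [h𝓔, Finset.sum_image hinj.injOn]
    have h4 : ∀ k ∈ Finset.Ico n (2 * n), 1 ≤ N (restrict (z k).support x) := by
      intro k hk
      have h5 : restrict (z k).support x = z k := by
        rw [hx, restrict_sum, Finset.sum_eq_single_of_mem k hk, restrict_eq_self]
        · exact fun j hj => Finsupp.mem_support_iff.2 hj
        · intro l _ hlk
          refine restrict_eq_zero fun j hj => ?_
          by_contra h0
          exact hlk (hb.eq_of_ne_zero h0 (Finsupp.mem_support_iff.1 hj))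
      rw [h5]
      exact h1 k
    have h6 := Finset.card_nsmul_le_sum _ _ _ h4
    rw [Nat.card_Ico, nsmul_eq_mul, mul_one, show 2 * n - n = n by lia] at h6
    exact h6
  have hpos : 0 < step θ A N x := lt_of_lt_of_le (mul_pos (hθ 1).1 hn0) hpx
  refine ⟨(step θ A N x)⁻¹ • x, Z.smul_mem _ (Z.sum_mem fun k _ => hz k), ?_, ?_⟩
  · rw [hp.smul, abs_of_pos (inv_pos.2 hpos), inv_mul_cancel₀ hpos.ne']
  · rw [hN.smul, abs_of_pos (inv_pos.2 hpos), ← div_eq_inv_mul, div_le_iff₀ hpos]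
    rw [div_lt_iff₀ (mul_pos (hθ 1).1 hε)] at hn
    have h3 := mul_le_mul_of_nonneg_left hpx hε.le
    linarith

theorem hasC0Sequences_supNorm : HasC0Sequences supNorm := by
  intro Z hZ
  obtain ⟨M, z, hM, hz⟩ := exists_seq_of_step (β := C00)
    (fun n z n' => z ∈ Z ∧ supNorm z = 1 ∧ (∀ j, z j ≠ 0 → n < j) ∧
      (∀ j, z j ≠ 0 → j ≤ n')) (by
    intro n
    obtain ⟨z, hz, hz0, hzn⟩ := hZ n
    obtain ⟨n', hn', hzn'⟩ := exists_support_le z n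
    obtain ⟨j, hj⟩ := Finsupp.ne_iff.1 hz0
    have hpos : 0 < supNorm z := lt_of_lt_of_le (abs_pos.2 hj) (abs_le_supNorm z j)
    have hz' : ∀ j, ((supNorm z)⁻¹ • z) j ≠ 0 → z j ≠ 0 := fun j hj h0 => hj (by
      rw [Finsupp.smul_apply, h0, smul_zero])
    refine ⟨(supNorm z)⁻¹ • z, n', hn', Z.smul_mem _ hz, ?_, fun j hj => ?_,
      fun j hj => hzn' j (hz' j hj)⟩
    · rw [tame_supNorm.smul, abs_of_pos (inv_pos.2 hpos), inv_mul_cancel₀ hpos.ne']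
    · by_contra hle
      exact hz' j hj (hzn j (not_lt.1 hle)))
  have hblock : IsBlock M z := ⟨hM, fun k => (hz k).2.2.1, fun k => (hz k).2.2.2⟩
  refine ⟨1 + 2, M, z, hblock, fun k => (hz k).1, fun k => (hz k).2.1.ge, fun n =>
    ciSup_le fun j => ?_⟩
  rw [Finsupp.finsetSum_apply]
  refine (Finset.abs_sum_le_sum_abs _ _).trans
    (sum_le_of_geometric zero_le_one (fun k => z k j ≠ 0) (fun k l => hblock.eq_of_ne_zero)
      (fun k => ?_) (fun k hk => ?_) n)
  · exact (abs_le_supNorm _ j).trans (hz k).2.1.le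
  · rw [not_not.1 hk, abs_zero]
    positivity

theorem hasC0Sequences_iterNorm (hθ : ∀ n, θ n ∈ Ioo (0 : ℝ) 1)
    (hθ0 : Tendsto θ atTop (𝓝 0)) (hAd : DisjointFams A) (hs : Splits A B) (m : ℕ) :
    HasC0Sequences (iterNorm θ A m) := by
  induction m with
  | zero => exact hasC0Sequences_supNorm
  | succ m ih =>
    have hN := tame_iterNorm hθ hAd m
    exact hasC0Sequences_step hθ hθ0 hAd hs hN (iterNorm_restrict_le hθ hAd m)
      fun Z hZ ε hε => ih.exists_small hθ hAd hs hN hZ hε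

end

/-! ### Saturation by `ℓ₁` -/

section

variable {θ : ℕ+ → ℝ} {A : ℕ+ → Set (Finset (Finset ℕ+))} {B : ℕ → Set (Finset (Finset ℕ+))}
  {α : ℕ+ → ℝ}

theorem le_sumNorm (hθ : ∀ n, θ n ∈ Ioo (0 : ℝ) 1) (hAd : DisjointFams A)
    (hα : ∀ n, α n ∈ Ioo (0 : ℝ) 1) (hsum : HasSum α 1) (n : ℕ+) (x : C00) :
    α n * iterNorm θ A n x ≤ sumNorm θ A α x :=
  (summable_sumNorm hθ hAd hα hsum x).le_tsum n fun m _ =>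
    mul_nonneg (hα m).1.le ((tame_iterNorm hθ hAd m).nonneg x)

theorem sumNorm_restrict_le (hθ : ∀ n, θ n ∈ Ioo (0 : ℝ) 1) (hAd : DisjointFams A)
    (hα : ∀ n, α n ∈ Ioo (0 : ℝ) 1) (hsum : HasSum α 1) (E : Finset ℕ+) (x : C00) :
    sumNorm θ A α (restrict E x) ≤ sumNorm θ A α x :=
  (summable_sumNorm hθ hAd hα hsum _).tsum_le_tsum (fun n =>
    mul_le_mul_of_nonneg_left (iterNorm_restrict_le hθ hAd n E x) (hα n).1.le)
    (summable_sumNorm hθ hAd hα hsum x)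

/-- A vector whose (m + 1)-st norm is 1 has sum norm at least α_{m+1}. Making the m-th norm at most
α_{m+1} ε beforehand therefore survives the normalization. -/
theorem exists_small_iterNorm (hθ : ∀ n, θ n ∈ Ioo (0 : ℝ) 1)
    (hθ0 : Tendsto θ atTop (𝓝 0)) (hAd : DisjointFams A) (hs : Splits A B)
    (hα : ∀ n, α n ∈ Ioo (0 : ℝ) 1) (hsum : HasSum α 1) {Z : Submodule ℝ C00} (hZ : Rich Z)
    (m : ℕ) {ε : ℝ} (hε : 0 < ε) : ∃ z ∈ Z, sumNorm θ A α z = 1 ∧ iterNorm θ A m z ≤ ε := by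
  have hN := tame_iterNorm hθ hAd m
  have hp := tame_sumNorm hθ hAd hα hsum
  have hα0 := (hα m.succPNat).1
  obtain ⟨z, hz, hz1, hzε⟩ := (hasC0Sequences_iterNorm hθ hθ0 hAd hs m).exists_small hθ hAd hs hN
    hZ (mul_pos hα0 hε)
  have h1 : α m.succPNat ≤ sumNorm θ A α z := by
    have h2 := le_sumNorm hθ hAd hα hsum m.succPNat z
    have h3 : iterNorm θ A m.succPNat z = 1 := hz1
    rwa [h3, mul_one] at h2
  have hpos : 0 < sumNorm θ A α z := hα0.trans_le h1
  refine ⟨(sumNorm θ A α z)⁻¹ • z, Z.smul_mem _ hz, ?_, ?_⟩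
  · rw [hp.smul, abs_of_pos (inv_pos.2 hpos), inv_mul_cancel₀ hpos.ne']
  · rw [hN.smul, abs_of_pos (inv_pos.2 hpos), ← div_eq_inv_mul, div_le_iff₀ hpos]
    refine hzε.trans ?_
    rw [mul_comm]
    exact mul_le_mul_of_nonneg_left h1 hε.le

/-- Every rich subspace of `c₀₀` contains a normalized sequence with a lower `ℓ₁` estimate. -/
theorem exists_lowerEll1_sumNorm (hθ : ∀ n, θ n ∈ Ioo (0 : ℝ) 1)
    (hθ0 : Tendsto θ atTop (𝓝 0)) (hAd : DisjointFams A) (hs : Splits A B)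
    (hα : ∀ n, α n ∈ Ioo (0 : ℝ) 1) (hsum : HasSum α 1) {Z : Submodule ℝ C00} (hZ : Rich Z) :
    ∃ w : ℕ → C00, (∀ k, w k ∈ Z) ∧ (∀ k, sumNorm θ A α (w k) = 1) ∧
      LowerEll1 (sumNorm θ A α) (1 / 2) w := by
  -- The k-th norm of w k is at most 1/(k + 1). Since the iterated norms increase, each fixed one
  -- tends to 0 along w while the sum norm stays 1, as the gliding hump requires.
  choose w hwZ hw1 hwε using fun k : ℕ => exists_small_iterNorm hθ hθ0 hAd hs hα hsum hZ k
    (Nat.one_div_pos_of_nat (α := ℝ) (n := k))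
  let ν : ℕ → Seminorm ℝ C00 := fun n => Seminorm.of
    (fun x => α n.succPNat * iterNorm θ A n.succPNat x)
    (fun x y => by
      rw [← mul_add]
      exact mul_le_mul_of_nonneg_left ((tame_iterNorm hθ hAd _).add x y) (hα _).1.le)
    (fun c x => by
      rw [(tame_iterNorm hθ hAd _).smul, Real.norm_eq_abs]
      ring)
  have hν : ∀ n x, ν n x = α n.succPNat * iterNorm θ A n.succPNat x := fun _ _ => rfl
  have hνsum : ∀ x, HasSum (fun n => ν n x) (sumNorm θ A α x) := fun x =>
    (Equiv.hasSum_iff Equiv.pnatEquivNat.symm).2 (summable_sumNorm hθ hAd hα hsum x).hasSum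
  obtain ⟨φ, -, hlow⟩ := exists_subseq_lower_l1 ν w (fun x => (hνsum x).summable) one_pos
    (fun k => by rw [(hνsum _).tsum_eq, hw1 k]) (fun n => by
      refine squeeze_zero' (Eventually.of_forall fun k => apply_nonneg _ _) ?_
        (tendsto_one_div_add_atTop_nhds_zero_nat (𝕜 := ℝ))
      filter_upwards [eventually_ge_atTop (n + 1)] with k hk
      refine le_trans ?_ (hwε k)
      rw [hν]
      exact (mul_le_of_le_one_left ((tame_iterNorm hθ hAd _).nonneg _) (hα _).2.le).trans
        (iterNorm_mono hθ hAd (w k) hk))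
  refine ⟨fun k => w (φ k), fun k => hwZ _, fun k => hw1 _, fun m a => ?_⟩
  rw [← (hνsum _).tsum_eq]
  exact hlow m a

end

/-! ### From rich subspaces of c₀₀ to closed subspaces of the completion. -/

section

variable {p : C00 → ℝ} (hp : Tame p)

/-- The `j`-th coordinate functional on a completion of `c₀₀`. -/
def coordinate (hsup : ∀ x, supNorm x ≤ p x) (j : ℕ+) : Compl hp.toSeminorm →L[ℝ] ℝ :=
  ContinuousLinearMap.fromCompletion (LinearMap.mkContinuous
    (E := Normed hp.toSeminorm) (σ := RingHom.id ℝ)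
    { toFun := fun x => (show C00 from x) j
      map_add' := fun _ _ => rfl
      map_smul' := fun _ _ => rfl } 1
    fun x => by
      rw [one_mul]
      exact (abs_le_supNorm _ j).trans (hsup _))

theorem coordinate_toCompl (hsup : ∀ x, supNorm x ≤ p x) (j : ℕ+) (x : C00) :
    coordinate hp hsup j (toCompl hp.toSeminorm x) = x j :=
  ContinuousLinearMap.fromCompletion_apply_coe _ _

theorem abs_coordinate_le (hsup : ∀ x, supNorm x ≤ p x) (j : ℕ+) (v : Compl hp.toSeminorm) :
    |coordinate hp hsup j v| ≤ ‖v‖ := by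
  have h : ∀ x, |coordinate hp hsup j (toCompl hp.toSeminorm x)| ≤ ‖toCompl hp.toSeminorm x‖ :=
    fun x => by
      rw [coordinate_toCompl, norm_toCompl]
      exact (abs_le_supNorm _ j).trans (hsup _)
  exact UniformSpace.Completion.induction_on (α := Normed hp.toSeminorm) v
    (isClosed_le (coordinate hp hsup j).continuous.abs continuous_norm) h

/-- Finitely many coordinates cannot separate the points of an infinite-dimensional subspace. -/
theorem exists_norm_one_coordinate_zero (hsup : ∀ x, supNorm x ≤ p x)
    {Y : Submodule ℝ (Compl hp.toSeminorm)} (hY : ¬ FiniteDimensional ℝ Y) (n : ℕ+) :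
    ∃ y ∈ Y, ‖y‖ = 1 ∧ ∀ j ≤ n, coordinate hp hsup j y = 0 := by
  let T : Y →ₗ[ℝ] (Finset.Iic n → ℝ) :=
    LinearMap.pi fun j => (coordinate hp hsup j).toLinearMap ∘ₗ Y.subtype
  have hT : ¬ Function.Injective T := fun h => hY (Module.Finite.of_injective T h)
  rw [← LinearMap.ker_eq_bot, Submodule.eq_bot_iff] at hT
  push Not at hT
  obtain ⟨y, hy, hy0⟩ := hT
  have hy0' : (y : Compl hp.toSeminorm) ≠ 0 := fun h => hy0 (Subtype.ext h)
  refine ⟨‖(y : Compl hp.toSeminorm)‖⁻¹ • (y : Compl hp.toSeminorm), Y.smul_mem _ y.2,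
    norm_smul_inv_norm hy0', fun j hj => ?_⟩
  have h1 : coordinate hp hsup j (y : Compl hp.toSeminorm) = 0 :=
    congrFun (LinearMap.mem_ker.1 hy) ⟨j, Finset.mem_Iic.2 hj⟩
  rw [map_smul, h1, smul_zero]

theorem exists_near_block_vector (hsup : ∀ x, supNorm x ≤ p x)
    {Y : Submodule ℝ (Compl hp.toSeminorm)} (hY : ¬ FiniteDimensional ℝ Y) (n : ℕ+) {ε : ℝ}
    (hε : 0 < ε) : ∃ y ∈ Y, ∃ u, p u = 1 ∧ (∀ j ≤ n, u j = 0) ∧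
      ‖toCompl hp.toSeminorm u - y‖ ≤ ε := by
  obtain ⟨y, hyY, hy1, hy0⟩ := exists_norm_one_coordinate_zero hp hsup hY n
  set r : ℝ := (n : ℕ) + 1 with hr
  have hr0 : 0 < r := by positivity
  -- Approximation costs δ and deleting the first n coordinates costs at most n δ, together min ε 1
  -- / 2. The remainder has norm at least 1/2, so normalizing at most doubles the error.
  set δ : ℝ := min ε 1 / (2 * r) with hδ
  have hm0 : 0 < min ε 1 := lt_min hε one_pos
  have hδ0 : 0 < δ := by positivity
  have hrδ : r * δ = min ε 1 / 2 := by rw [hδ]; field_simp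
  obtain ⟨x, hx⟩ := exists_toCompl_near hp.toSeminorm y hδ0
  have hxy : ‖toCompl hp.toSeminorm x - y‖ < δ := by rwa [norm_sub_rev]
  have hxj : ∀ j ≤ n, |x j| ≤ δ := by
    intro j hj
    have h1 := abs_coordinate_le hp hsup j (toCompl hp.toSeminorm x - y)
    rw [map_sub, coordinate_toCompl, hy0 j hj, sub_zero] at h1
    exact h1.trans hxy.le
  set w := restrict (Finset.Iic n) x with hw
  have hpw : p w ≤ (n : ℕ) * δ := by
    refine (hp.le_l1 w).trans ?_
    have hsub : w.support ⊆ Finset.Iic n := fun j hj => by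
      by_contra hjn
      rw [Finsupp.mem_support_iff, hw, restrict_apply, if_neg hjn] at hj
      exact hj rfl
    have h1 : l1Norm w ≤ w.support.card • δ := Finset.sum_le_card_nsmul _ _ _ fun j hj => by
      rw [hw, restrict_apply, if_pos (hsub hj)]
      exact hxj j (Finset.mem_Iic.1 (hsub hj))
    have h2 : w.support.card ≤ n := by
      refine (Finset.card_le_card hsub).trans ?_
      have : (Finset.Iic n) = Finset.Icc 1 n := by ext; simp
      rw [this, PNat.card_Icc]
      simp
    rw [nsmul_eq_mul] at h1
    exact h1.trans (mul_le_mul_of_nonneg_right (by exact_mod_cast h2) hδ0.le)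
  have hdist : ‖toCompl hp.toSeminorm (x - w) - y‖ ≤ r * δ := by
    have h1 : toCompl hp.toSeminorm (x - w) - y =
        (toCompl hp.toSeminorm x - y) - toCompl hp.toSeminorm w := by
      rw [map_sub]; abel
    rw [h1]
    refine (norm_sub_le _ _).trans ?_
    rw [norm_toCompl, toSeminorm_apply, hr]
    linarith
  have hpu : 1 / 2 ≤ p (x - w) := by
    have h1 := norm_le_norm_add_norm_sub (toCompl hp.toSeminorm (x - w)) y
    rw [norm_toCompl, toSeminorm_apply, hy1] at h1
    have h2 := min_le_right ε 1
    linarith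
  have hpos : 0 < p (x - w) := by linarith
  refine ⟨(p (x - w))⁻¹ • y, Y.smul_mem _ hyY, (p (x - w))⁻¹ • (x - w), ?_, fun j hj => ?_, ?_⟩
  · rw [hp.smul, abs_of_pos (inv_pos.2 hpos), inv_mul_cancel₀ hpos.ne']
  · rw [Finsupp.smul_apply, Finsupp.sub_apply, hw, restrict_apply,
      if_pos (Finset.mem_Iic.2 hj), sub_self, smul_zero]
  · rw [map_smul, ← smul_sub, norm_smul, norm_inv, Real.norm_eq_abs, abs_of_pos hpos,
      ← div_eq_inv_mul, div_le_iff₀ hpos]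
    refine hdist.trans ?_
    rw [hrδ]
    have h2 := min_le_left ε 1
    nlinarith

/-- If every rich subspace of `c₀₀` contains a normalized sequence with a lower `ℓ₁` estimate, then
the completion is `ℓ₁`-saturated. -/
theorem isEll1Saturated_compl (hsup : ∀ x, supNorm x ≤ p x)
    (hres : ∀ E x, p (restrict E x) ≤ p x)
    (hrich : ∀ Z, Rich Z → ∃ w : ℕ → C00, (∀ k, w k ∈ Z) ∧ (∀ k, p (w k) = 1) ∧
      LowerEll1 p (1 / 2) w) : IsEll1Saturated (Compl hp.toSeminorm) := by
  intro Y hYc hY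
  obtain ⟨M, b, hM, hb⟩ := exists_seq_of_step (β := C00 × Compl hp.toSeminorm)
    (fun n b n' => b.2 ∈ Y ∧ p b.1 = 1 ∧ (∀ j, b.1 j ≠ 0 → n < j) ∧ (∀ j, b.1 j ≠ 0 → j ≤ n') ∧
      ‖toCompl hp.toSeminorm b.1 - b.2‖ ≤ (1 / 2) ^ (n : ℕ) / 4) (by
    intro n
    obtain ⟨y, hy, u, hu1, hu0, huy⟩ := exists_near_block_vector hp hsup hY n
      (show (0 : ℝ) < (1 / 2) ^ (n : ℕ) / 4 by positivity)
    obtain ⟨n', hn', hun'⟩ := exists_support_le u n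
    refine ⟨(u, y), n', hn', hy, hu1, fun j hj => ?_, hun', huy⟩
    by_contra hle
    exact hj (hu0 j (not_lt.1 hle)))
  let u : ℕ → C00 := fun k => (b k).1
  let y : ℕ → Compl hp.toSeminorm := fun k => (b k).2
  have hblock : IsBlock M u := ⟨hM, fun k => (hb k).2.2.1, fun k => (hb k).2.2.2.1⟩
  have hu1 : ∀ k, p (u k) = 1 := fun k => (hb k).2.1
  have huy : ∀ k, ‖toCompl hp.toSeminorm (u k) - y k‖ ≤ (1 / 2) ^ k / 4 := fun k =>
    (hb k).2.2.2.2.trans (div_le_div_of_nonneg_right (half_pow_le hM k) (by norm_num))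
  -- Restriction to the i-th window isolates the i-th block. With errors 2^{-k}/4, which sum to at
  -- most 1/2, replacing each u k by y k changes a combination by at most half its norm.
  have hcoef : ∀ (c : ℕ →₀ ℝ) i, |c i| ≤ p (Finsupp.linearCombination ℝ u c) := by
    intro c i
    have h1 : restrict (Finset.Ioc (M i) (M (i + 1))) (Finsupp.linearCombination ℝ u c) =
        c i • u i := by
      rw [Finsupp.linearCombination_apply, Finsupp.sum, restrict_sum,
        Finset.sum_eq_single i]
      · refine restrict_eq_self fun j hj => ?_
        have hj' : u i j ≠ 0 := fun h => hj (by rw [Finsupp.smul_apply, h, smul_zero])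
        exact Finset.mem_Ioc.2 ⟨hblock.lt i j hj', hblock.le i j hj'⟩
      · intro k _ hk
        refine restrict_eq_zero fun j hj => ?_
        rw [Finset.mem_Ioc] at hj
        rw [Finsupp.smul_apply]
        by_contra h0
        have hj' : u k j ≠ 0 := fun h => h0 (by rw [h, smul_zero])
        have h2 := hblock.lt k j hj'
        have h3 := hblock.le k j hj'
        rcases lt_or_gt_of_ne hk with h | h
        · exact absurd (h3.trans (hM.monotone h)) (not_le.2 hj.1)
        · exact absurd (h2.trans_le hj.2) (not_lt.2 (hM.monotone h))
      · intro hi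
        rw [Finsupp.notMem_support_iff.1 hi, zero_smul]
        exact restrict_eq_zero fun _ _ => rfl
    have h2 := hres (Finset.Ioc (M i) (M (i + 1))) (Finsupp.linearCombination ℝ u c)
    rwa [h1, hp.smul, hu1, mul_one] at h2
  have hpert : ∀ c : ℕ →₀ ℝ, ‖toCompl hp.toSeminorm (Finsupp.linearCombination ℝ u c) -
      Finsupp.linearCombination ℝ y c‖ ≤ p (Finsupp.linearCombination ℝ u c) / 2 := by
    intro c
    obtain ⟨n, hn⟩ := c.support.exists_nat_subset_range
    rw [Finsupp.linearCombination_apply ℝ (v := y), Finsupp.sum_of_support_subset c hn _ (by simp)]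
    have h1 : toCompl hp.toSeminorm (Finsupp.linearCombination ℝ u c) =
        ∑ i ∈ Finset.range n, c i • toCompl hp.toSeminorm (u i) := by
      rw [Finsupp.linearCombination_apply, Finsupp.sum_of_support_subset c hn _ (by simp), map_sum]
      simp only [map_smul]
    rw [h1, ← Finset.sum_sub_distrib]
    set P := p (Finsupp.linearCombination ℝ u c) with hP
    have hP0 : 0 ≤ P := hp.nonneg _
    refine (norm_sum_le_of_le _ (f := fun i => c i • toCompl hp.toSeminorm (u i) - c i • y i)
      (n := fun i => P / 4 * (1 / 2) ^ i) fun i _ => ?_).trans ?_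
    · rw [← smul_sub, norm_smul, Real.norm_eq_abs]
      refine (mul_le_mul (hcoef c i) (huy i) (norm_nonneg _) hP0).trans (le_of_eq ?_)
      ring
    · rw [← Finset.mul_sum]
      nlinarith [sum_geometric_two_le n]
  obtain ⟨w, hwZ, hw1, hlow⟩ := hrich (Submodule.span ℝ (range u)) fun n => by
    refine ⟨u n, Submodule.subset_span ⟨n, rfl⟩, fun h => ?_, fun j hj => ?_⟩
    · have := hu1 n
      rw [h, hp.zero] at this
      exact zero_ne_one this
    · by_contra h0
      have h1 : M n < j := hblock.lt n j h0
      have h2 : (n : ℕ) < M n := lt_of_strictMono_pnat hM n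
      exact absurd (h1.trans_le hj) (not_lt.2 (PNat.coe_le_coe _ _ |>.1 h2.le))
  simp only [← Finsupp.range_linearCombination, LinearMap.mem_range] at hwZ
  choose c hc using hwZ
  -- The perturbation keeps norms between 1/2 and 3/2 of their value, so the lower constant 1/2
  -- becomes 1/4 and the norms of the new vectors are at most 3/2.
  refine exists_isomorphicToEll1 hYc (w := fun k => Finsupp.linearCombination ℝ y (c k))
    (fun k => ?_) (C := 3 / 2) (c := 1 / 4) (by norm_num) (fun k => ?_) fun m a => ?_
  · rw [Finsupp.linearCombination_apply]
    exact Y.sum_mem fun i _ => Y.smul_mem _ (hb i).1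
  · have h1 := hpert (c k)
    have h2 := norm_le_norm_add_norm_sub (toCompl hp.toSeminorm (w k))
      (Finsupp.linearCombination ℝ y (c k))
    rw [norm_toCompl, toSeminorm_apply, hw1] at h2
    rw [hc, hw1] at h1
    linarith
  · have h1 := hpert (∑ k ∈ Finset.range m, a k • c k)
    simp only [map_sum, map_smul, hc] at h1
    have h2 := hlow m a
    have h3 := norm_le_norm_add_norm_sub' (toCompl hp.toSeminorm (∑ k ∈ Finset.range m, a k • w k))
      (∑ k ∈ Finset.range m, a k • Finsupp.linearCombination ℝ y (c k))
    rw [norm_toCompl, toSeminorm_apply] at h3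
    simp only [map_sum, map_smul] at h3
    linarith

end

/-! ### The families defining `V` and `W` -/

theorem IsAllowable.sub {n : ℕ} {𝓔 𝓕 : Finset (Finset ℕ+)} (h : IsAllowable (n + 1) 𝓔)
    (hsub : 𝓕 ⊆ 𝓔) (hm : MinsInSchreier n 𝓕) : IsAllowable n 𝓕 :=
  ⟨fun E hE => h.nonempty E (hsub hE), fun E hE F hF => h.disjoint E (hsub hE) F (hsub hF), hm⟩

theorem IsAdmissible.sub {n : ℕ} {𝓔 𝓕 : Finset (Finset ℕ+)} (h : IsAdmissible (n + 1) 𝓔)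
    (hsub : 𝓕 ⊆ 𝓔) (hm : MinsInSchreier n 𝓕) : IsAdmissible n 𝓕 :=
  ⟨fun E hE => h.nonempty E (hsub hE), fun E hE F hF => h.successive E (hsub hE) F (hsub hF), hm⟩

theorem splits_famV : Splits famV fun n => {𝓔 | IsAllowable n 𝓔} where
  eq _ := rfl
  allowable _ _ h := h
  one _ h := h
  sub _ _ h _ hsub hm := IsAllowable.sub h hsub hm

/-- The only change of type is from level s + 1 to level s, where admissible families become
allowable ones; the reverse passage never occurs. -/
theorem splits_famW (s : ℕ+) : Splits (famW s) fun n =>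
    {𝓔 | (n ≤ s ∧ IsAllowable n 𝓔) ∨ ((s : ℕ) + 1 ≤ n ∧ IsAdmissible n 𝓔)} where
  eq n := rfl
  allowable n 𝓔 h := h.elim And.right fun h => h.2.isAllowable
  one 𝓔 h := Or.inl ⟨s.pos, h⟩
  sub n 𝓔 h 𝓕 hsub hm := by
    rcases h with ⟨hn, h⟩ | ⟨hn, h⟩
    · exact Or.inl ⟨by lia, h.sub hsub hm⟩
    · rcases Nat.lt_or_ge s n with hsn | hsn
      · exact Or.inr ⟨hsn, h.sub hsub hm⟩
      · exact Or.inl ⟨hsn, h.isAllowable.sub hsub hm⟩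

/-! ### The two conclusions for families that split. -/

section

variable {θ : ℕ+ → ℝ} {A : ℕ+ → Set (Finset (Finset ℕ+))} {B : ℕ → Set (Finset (Finset ℕ+))}
  {α : ℕ+ → ℝ}

theorem Splits.not_containsEll1 (hs : Splits A B) (hθ : ∀ n, θ n ∈ Ioo (0 : ℝ) 1)
    (hθ0 : Tendsto θ atTop (𝓝 0)) (hAd : DisjointFams A) :
    ¬ ContainsEll1 (Compl (tame_limNorm hθ hAd).toSeminorm) :=
  not_containsEll1_compl_limNorm hθ hθ0 hAd (fun n 𝓔 h => hs.allowable n 𝓔 (hs.eq n ▸ h))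
    fun 𝓔 h => (hs.eq 1).symm ▸ hs.one 𝓔 h

theorem Splits.isEll1Saturated (hs : Splits A B) (hθ : ∀ n, θ n ∈ Ioo (0 : ℝ) 1)
    (hθ0 : Tendsto θ atTop (𝓝 0)) (hAd : DisjointFams A)
    (hα : ∀ n, α n ∈ Ioo (0 : ℝ) 1) (hsum : HasSum α 1) :
    IsEll1Saturated (Compl (tame_sumNorm hθ hAd hα hsum).toSeminorm) ∧
      ¬ IsomorphicToEll1 (Compl (tame_sumNorm hθ hAd hα hsum).toSeminorm) :=
  ⟨isEll1Saturated_compl _ (supNorm_le_sumNorm hθ hAd hα hsum)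
    (sumNorm_restrict_le hθ hAd hα hsum)
    fun _ hZ => exists_lowerEll1_sumNorm hθ hθ0 hAd hs hα hsum hZ,
  not_isomorphicToEll1_compl_sumNorm hθ hθ0 hAd (fun n 𝓔 h => hs.allowable n 𝓔 (hs.eq n ▸ h))
    (fun 𝓔 h => (hs.eq 1).symm ▸ hs.one 𝓔 h) hα hsum⟩

end

end MixedTsirelson

end

open MixedTsirelson in
theorem proposition3p3
    (θ : ℕ+ → ℝ) (hθ : ∀ n, θ n ∈ Set.Ioo (0 : ℝ) 1)
    (hθ0 : Filter.Tendsto θ Filter.atTop (nhds 0))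
    (s : ℕ+)
    (α : ℕ+ → ℝ) (hα : ∀ n, α n ∈ Set.Ioo (0 : ℝ) 1) (hsum : HasSum α 1)
    (hratio : ∃ l u : ℝ, 0 < l ∧ u < 1 ∧ ∀ n, l ≤ α (n + 1) / α n ∧ α (n + 1) / α n ≤ u) :
    ¬ ContainsEll1 (V θ hθ) ∧
    ¬ ContainsEll1 (W s θ hθ) ∧
    (IsEll1Saturated (V' θ hθ α hα hsum) ∧ ¬ IsomorphicToEll1 (V' θ hθ α hα hsum)) ∧
    (IsEll1Saturated (W' s θ hθ α hα hsum) ∧ ¬ IsomorphicToEll1 (W' s θ hθ α hα hsum)) :=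
  ⟨splits_famV.not_containsEll1 hθ hθ0 disjointFams_famV,
    (splits_famW s).not_containsEll1 hθ hθ0 (disjointFams_famW s),
    splits_famV.isEll1Saturated hθ hθ0 disjointFams_famV hα hsum,
    (splits_famW s).isEll1Saturated hθ hθ0 (disjointFams_famW s) hα hsum⟩
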